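/- Let $n\ge 1$, let $\vec p=(p_1,\dots,p_n)$ with $0<p_j<\infty$ for every $j$, and let $0<t<\min(p_1,\dots,p_n)$. For a measurable function $g$ on $\mathbb R^n$ (with values in $\mathbb C$ or in $[0,\infty]$) put $$\|g\|_{\vec p}=\left(\int_{\mathbb R}\cdots\left(\int_{\mathbb R}\left(\int_{\mathbb R}|g(x_1,x_2,\dots,x_n)|^{p_1}\,dx_1\right)^{\frac{p_2}{p_1}}dx_2\right)^{\frac{p_3}{p_2}}\cdots dx_n\right)^{\frac1{p_n}},$$ and let $L^{\vec p}(\mathbb R^n)$ be the set of measurable $f:\mathbb R^n\to\mathbb C$ with $\|f\|_{\vec p}<\infty$. For $1\le k\le n$ let $$M_kg(x)=\sup_{I\ni x_k}\frac1{|I|}\int_I|g(x_1,\dots,x_{k-1},y_k,x_{k+1},\dots,x_n)|\,dy_k,$$ where $I$ ranges over the bounded nondegenerate intervals of $\mathbb R$ containing $x_k$, and let $$\mathcal M_tf(x)=\big(M_n\cdots M_1[|f|^t](x)\big)^{1/t}.$$ Then there is a constant $C>0$, depending only on $n$, $\vec p$ and $t$, such that for every $f\in L^{\vec p}(\mathbb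 R^n)$ the function $\mathcal M_tf:\mathbb R^n\to[0,\infty]$ is measurable and $$\|\mathcal M_tf\|_{\vec p}\le C\,\|f\|_{\vec p}.$$ -/

import Mathlib

open MeasureTheory
open scoped ENNReal NNReal

noncomputable section

/-- The mixed Lebesgue norm of a `[0, ∞]`-valued function on `ℝⁿ`, for finite exponents: the
integration in `x₁` is innermost, the one in `xₙ` is outermost.  For `n = 0` it is the value of the
function at the only point. -/
def mixedNorm : {n : ℕ} → (Fin n → ℝ) → ((Fin n → ℝ) → ℝ≥0∞) → ℝ≥0∞
  | 0, _, F => F Fin.elim0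
  | n + 1, p, F =>
      (∫⁻ s : ℝ, mixedNorm (fun j : Fin n => p j.castSucc)
          (fun y : Fin n → ℝ => F (Fin.snoc (α := fun _ => ℝ) y s)) ^ p (Fin.last n))
        ^ (1 / p (Fin.last n))

/-- The mixed Lebesgue space: the (Lebesgue) measurable functions `f : ℝⁿ → ℂ` whose mixed norm is
finite.  `AEMeasurable f volume` says that `f` is Lebesgue measurable. -/
def mixedLebesgue {n : ℕ} (p : Fin n → ℝ) : Set ((Fin n → ℝ) → ℂ) :=
  {f | AEMeasurable f volume ∧ mixedNorm p (fun x => ‖f x‖ₑ) < ∞}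

/-- The one-dimensional uncentered maximal operator in the `k`-th variable.  Since points are null
sets, the supremum over the closed bounded intervals `[a, b] ∋ x k` with `a < b` is the supremum over
all bounded nondegenerate intervals containing `x k`. -/
def directionalMaximal {n : ℕ} (k : Fin n) (F : (Fin n → ℝ) → ℝ≥0∞) (x : Fin n → ℝ) : ℝ≥0∞ :=
  ⨆ (a : ℝ) (b : ℝ) (_ : a < b) (_ : x k ∈ Set.Icc a b),
    (∫⁻ s in Set.Icc a b, F (Function.update x k s)) / ENNReal.ofReal (b - a)

/-- The composition `Mₙ ⋯ M₁ F` (the operator in the first variable is applied first). -/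
def composedMaximal {n : ℕ} (F : (Fin n → ℝ) → ℝ≥0∞) : (Fin n → ℝ) → ℝ≥0∞ :=
  Fin.foldl n (fun G k => directionalMaximal k G) F

/-- The iterated maximal operator `(Mₙ ⋯ M₁ [|f| ^ t]) ^ (1 / t)`. -/
def iteratedMaximal {n : ℕ} (t : ℝ) (f : (Fin n → ℝ) → ℂ) (x : Fin n → ℝ) : ℝ≥0∞ :=
  composedMaximal (fun y => ‖f y‖ₑ ^ t) x ^ (1 / t)

end

/-!
Among finitely many closed intervals one can choose some with the same union and such that no point
lies in more than two of them. Hence the uncentered maximal operator of an arbitrary measure on the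
line is bounded on `L^p`, `1 < p`, with a constant that does not depend on the measure. Lerner's
pointwise estimate of the Hardy–Littlewood maximal function by maximal functions of the measures
`w dx` and `w^(-1/(p-1)) dx` turns this into the `A_p`-weighted estimate. Extrapolation, with
Rubio de Francia's majorants, transfers the weighted estimates from one exponent to all others; by
induction on the number of variables they therefore hold for functions with values in a mixed-norm
space, all of whose exponents exceed one. Applied in the last variable, this bounds `Mₙ ⋯ M₁`
inductively; the theorem is the case of `|f|^t` and the exponents `p_j / t`.
-/

open Set Filter Topology

/-! ### A covering lemma for intervals -/

section Covering

variable {ι α : Type*} [LinearOrder α] (a b : ι → α)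

theorem exists_Icc_subset_biUnion_erase [DecidableEq ι] {S : Finset ι} {x : α}
    (hx : ∀ i ∈ S, x ∈ Icc (a i) (b i)) (hS : 2 < S.card) :
    ∃ k ∈ S, Icc (a k) (b k) ⊆ ⋃ i ∈ S.erase k, Icc (a i) (b i) := by
  have hne : S.Nonempty := Finset.card_pos.1 (by lia)
  obtain ⟨i, hi, hmin⟩ := S.exists_min_image a hne
  obtain ⟨j, hj, hmax⟩ := S.exists_max_image b hne
  obtain ⟨k, hk, hkij⟩ := Finset.exists_mem_notMem_of_card_lt_card
    (Finset.card_le_two.trans_lt hS : ({i, j} : Finset ι).card < S.card)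
  simp only [Finset.mem_insert, Finset.mem_singleton, not_or] at hkij
  refine ⟨k, hk, fun y hy => ?_⟩
  simp only [mem_iUnion, Finset.mem_erase, exists_prop]
  rcases le_total y x with hyx | hxy
  · exact ⟨i, ⟨Ne.symm hkij.1, hi⟩, (hmin k hk).trans hy.1, hyx.trans (hx i hi).2⟩
  · exact ⟨j, ⟨Ne.symm hkij.2, hj⟩, (hx j hj).1.trans hxy, hy.2.trans (hmax k hk)⟩

theorem exists_subset_biUnion_Icc_overlap_le_two (S : Finset ι) :
    ∃ T ⊆ S, (⋃ i ∈ S, Icc (a i) (b i)) ⊆ ⋃ i ∈ T, Icc (a i) (b i) ∧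
      ∀ x, (T.filter fun i => x ∈ Icc (a i) (b i)).card ≤ 2 := by
  classical
  induction S using Finset.strongInduction with
  | H S ih =>
  by_cases hS : ∀ x, (S.filter fun i => x ∈ Icc (a i) (b i)).card ≤ 2
  · exact ⟨S, Subset.rfl, Subset.rfl, hS⟩
  push Not at hS
  obtain ⟨x, hx⟩ := hS
  obtain ⟨k, hk, hsub⟩ := exists_Icc_subset_biUnion_erase a b
    (fun i hi => (Finset.mem_filter.1 hi).2) hx
  have hkS : k ∈ S := Finset.mem_of_mem_filter k hk
  obtain ⟨T, hTS, hT, hcard⟩ := ih _ (Finset.erase_ssubset hkS)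
  refine ⟨T, hTS.trans (S.erase_subset k), Subset.trans (iUnion₂_subset fun i hi => ?_) hT, hcard⟩
  by_cases hik : i = k
  · rw [hik]
    exact hsub.trans (biUnion_subset_biUnion_left
      (Finset.erase_subset_erase k (Finset.filter_subset _ S)))
  · exact subset_biUnion_of_mem (u := fun i => Icc (a i) (b i)) (Finset.mem_erase.2 ⟨hik, hi⟩)

end Covering

/-! ### The maximal function of a measure on the line -/

theorem measurable_iSup_mem {ι α : Type*} [Countable ι] [MeasurableSpace α] {s : ι → Set α}
    {f : ι → α → ℝ≥0∞} (hs : ∀ i, MeasurableSet (s i)) (hf : ∀ i, Measurable (f i)) :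
    Measurable fun x => ⨆ (i) (_ : x ∈ s i), f i x := by
  classical
  refine .iSup fun i => ?_
  convert (hf i).indicator (hs i) using 2 with x
  by_cases hx : x ∈ s i <;> simp [hx]

/-- The uncentered maximal function of `f` with respect to `μ`. Only intervals with rational
endpoints enter, so that it is a countable supremum, hence measurable. -/
noncomputable def intervalMaximal (μ : Measure ℝ) (f : ℝ → ℝ≥0∞) (x : ℝ) : ℝ≥0∞ :=
  ⨆ (q : ℚ × ℚ) (_ : x ∈ Icc (q.1 : ℝ) q.2), ⨍⁻ y in Icc (q.1 : ℝ) q.2, f y ∂μ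

section MaximalFunction

variable {μ : Measure ℝ} {f g : ℝ → ℝ≥0∞} {x : ℝ} {c : ℝ≥0∞}

theorem intervalMaximal_le_iff : intervalMaximal μ f x ≤ c ↔
    ∀ q : ℚ × ℚ, x ∈ Icc (q.1 : ℝ) q.2 → ⨍⁻ y in Icc (q.1 : ℝ) q.2, f y ∂μ ≤ c :=
  iSup₂_le_iff

theorem lt_intervalMaximal_iff : c < intervalMaximal μ f x ↔
    ∃ q : ℚ × ℚ, x ∈ Icc (q.1 : ℝ) q.2 ∧ c < ⨍⁻ y in Icc (q.1 : ℝ) q.2, f y ∂μ := by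
  simp only [intervalMaximal, lt_iSup_iff, exists_prop]

theorem setLAverage_le_intervalMaximal (q : ℚ × ℚ) (hx : x ∈ Icc (q.1 : ℝ) q.2) :
    ⨍⁻ y in Icc (q.1 : ℝ) q.2, f y ∂μ ≤ intervalMaximal μ f x :=
  intervalMaximal_le_iff.1 le_rfl q hx

theorem setLIntegral_Icc_le_intervalMaximal_mul (q : ℚ × ℚ) (hx : x ∈ Icc (q.1 : ℝ) q.2)
    (hq : μ (Icc (q.1 : ℝ) q.2) ≠ ∞) :
    ∫⁻ y in Icc (q.1 : ℝ) q.2, f y ∂μ ≤ intervalMaximal μ f x * μ (Icc (q.1 : ℝ) q.2) := by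
  by_cases h0 : μ (Icc (q.1 : ℝ) q.2) = 0
  · simp [setLIntegral_measure_zero _ _ h0]
  · rw [← ENNReal.div_le_iff h0 hq, ← setLAverage_eq]
    exact setLAverage_le_intervalMaximal q hx

variable (μ f) in
theorem measurable_intervalMaximal : Measurable (intervalMaximal μ f) :=
  measurable_iSup_mem (fun _ => measurableSet_Icc) fun _ => measurable_const

theorem intervalMaximal_le_add (hg : Measurable g) (h : ∀ x, f x ≤ g x + c) (x : ℝ) :
    intervalMaximal μ f x ≤ intervalMaximal μ g x + c := by
  refine intervalMaximal_le_iff.2 fun q hx => ?_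
  set I := Icc (q.1 : ℝ) q.2
  calc ⨍⁻ y in I, f y ∂μ ≤ ⨍⁻ y in I, (g y + c) ∂μ := lintegral_mono h
    _ = (⨍⁻ y in I, g y ∂μ) + c * (μ I / μ I) := by
        simp only [setLAverage_eq, lintegral_add_left hg, setLIntegral_const, ENNReal.add_div,
          mul_div_assoc]
    _ ≤ intervalMaximal μ g x + c := by
        gcongr
        · exact setLAverage_le_intervalMaximal q hx
        · exact mul_le_of_le_one_right' ENNReal.div_self_le_one

theorem mul_measure_biUnion_Icc_le {ι : Type*} {a b : ι → ℝ} (hf : Measurable f) (S : Finset ι)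
    (hS : ∀ i ∈ S, c * μ (Icc (a i) (b i)) ≤ ∫⁻ y in Icc (a i) (b i), f y ∂μ) :
    c * μ (⋃ i ∈ S, Icc (a i) (b i)) ≤ 2 * ∫⁻ y, f y ∂μ := by
  classical
  obtain ⟨T, hTS, hT, hcard⟩ := exists_subset_biUnion_Icc_overlap_le_two a b S
  calc c * μ (⋃ i ∈ S, Icc (a i) (b i))
      ≤ c * ∑ i ∈ T, μ (Icc (a i) (b i)) := by
        gcongr
        exact (measure_mono hT).trans (measure_biUnion_finset_le _ _)
    _ ≤ ∑ i ∈ T, ∫⁻ y in Icc (a i) (b i), f y ∂μ := by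
        rw [Finset.mul_sum]
        exact Finset.sum_le_sum fun i hi => hS i (hTS hi)
    _ = ∫⁻ y, ∑ i ∈ T, (Icc (a i) (b i)).indicator f y ∂μ := by
        rw [lintegral_finsetSum _ fun i _ => hf.indicator measurableSet_Icc]
        simp only [lintegral_indicator measurableSet_Icc]
    _ ≤ ∫⁻ y, 2 * f y ∂μ := by
        refine lintegral_mono fun y => ?_
        simp only [indicator_apply, ← Finset.sum_filter, Finset.sum_const, nsmul_eq_mul]
        gcongr
        exact_mod_cast hcard y
    _ = 2 * ∫⁻ y, f y ∂μ := lintegral_const_mul _ hf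

theorem mul_measure_lt_intervalMaximal_le (hf : Measurable f) (c : ℝ≥0∞) :
    c * μ {x | c < intervalMaximal μ f x} ≤ 2 * ∫⁻ x, f x ∂μ := by
  classical
  let I : ℚ × ℚ → Set ℝ := fun q => Icc (q.1 : ℝ) q.2
  let B : Set (ℚ × ℚ) := {q | c < ⨍⁻ y in I q, f y ∂μ}
  have hset : {x | c < intervalMaximal μ f x} ⊆ ⋃ S : Finset B, ⋃ q ∈ S, I q := by
    intro x hx
    obtain ⟨q, hxq, hq⟩ := lt_intervalMaximal_iff.1 hx
    exact mem_iUnion.2 ⟨{⟨q, hq⟩}, mem_biUnion (Finset.mem_singleton_self _) hxq⟩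
  have hmono : Monotone fun S : Finset B => ⋃ q ∈ S, I q :=
    fun S T hST => biUnion_subset_biUnion_left hST
  have hB (q : B) : c * μ (I q) ≤ ∫⁻ y in I q, f y ∂μ :=
    ENNReal.mul_le_of_le_div (setLAverage_eq (μ := μ) f (I q) ▸ le_of_lt q.2)
  calc c * μ {x | c < intervalMaximal μ f x}
      ≤ c * μ (⋃ S : Finset B, ⋃ q ∈ S, I q) := by gcongr
    _ = ⨆ S : Finset B, c * μ (⋃ q ∈ S, I q) := by
        rw [hmono.directed_le.measure_iUnion, ENNReal.mul_iSup]
    _ ≤ 2 * ∫⁻ x, f x ∂μ := iSup_le fun S => mul_measure_biUnion_Icc_le hf S fun q _ => hB q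

theorem mul_measure_lt_intervalMaximal_le_setLIntegral (hf : Measurable f) (c : ℝ≥0∞) :
    c * μ {x | c < intervalMaximal μ f x} ≤ 4 * ∫⁻ x in {x | c < 2 * f x}, f x ∂μ := by
  have hs : MeasurableSet {x | c < 2 * f x} := measurableSet_lt measurable_const (hf.const_mul 2)
  set g := {x | c < 2 * f x}.indicator f
  have hg : Measurable g := hf.indicator hs
  have hle (x : ℝ) : f x ≤ g x + c / 2 := by
    by_cases hx : c < 2 * f x
    · exact (indicator_of_mem (s := {x | c < 2 * f x}) hx f).ge.trans le_self_add
    · refine le_add_left ((ENNReal.le_div_iff_mul_le (by simp) (by simp)).2 ?_)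
      rw [mul_comm]
      exact not_lt.1 hx
  have hsub : {x | c < intervalMaximal μ f x} ⊆ {x | c / 2 < intervalMaximal μ g x} := by
    intro x (hx : c < intervalMaximal μ f x)
    by_contra! hgx
    refine hx.not_ge ?_
    calc intervalMaximal μ f x ≤ intervalMaximal μ g x + c / 2 := intervalMaximal_le_add hg hle x
      _ ≤ c / 2 + c / 2 := by gcongr; exact not_lt.1 hgx
      _ = c := ENNReal.add_halves c
  calc c * μ {x | c < intervalMaximal μ f x}
      ≤ c * μ {x | c / 2 < intervalMaximal μ g x} := by gcongr
    _ = 2 * (c / 2 * μ {x | c / 2 < intervalMaximal μ g x}) := by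
        rw [← mul_assoc, ENNReal.mul_div_cancel (by simp) (by simp)]
    _ ≤ 2 * (2 * ∫⁻ x, g x ∂μ) := by
        gcongr 2 * ?_
        exact mul_measure_lt_intervalMaximal_le hg _
    _ = 4 * ∫⁻ x in {x | c < 2 * f x}, f x ∂μ := by
        rw [lintegral_indicator hs, ← mul_assoc]
        norm_num

end MaximalFunction

/-! ### Layer cake formula and the strong type inequality -/

section LayerCake

variable {α : Type*} [MeasurableSpace α] (μ : Measure α) {f : α → ℝ≥0∞} {q : ℝ}

theorem lintegral_rpow_eq_lintegral_measure_lt_of_ne_top (hf : Measurable f) (hft : ∀ x, f x ≠ ∞)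
    (hq : 0 < q) : ∫⁻ x, f x ^ q ∂μ = ENNReal.ofReal q *
      ∫⁻ l in Ioi (0 : ℝ), μ {x | ENNReal.ofReal l < f x} * ENNReal.ofReal (l ^ (q - 1)) := by
  have h := lintegral_rpow_eq_lintegral_meas_lt_mul μ (f := fun x => (f x).toReal)
    (Eventually.of_forall fun _ => ENNReal.toReal_nonneg) hf.ennreal_toReal.aemeasurable hq
  simp only [← ENNReal.ofReal_rpow_of_nonneg ENNReal.toReal_nonneg hq.le,
    ENNReal.ofReal_toReal (hft _)] at h
  rw [h]
  congr 1
  refine setLIntegral_congr_fun measurableSet_Ioi fun l hl => ?_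
  simp only [ENNReal.ofReal_lt_iff_lt_toReal (le_of_lt hl) (hft _)]

theorem lintegral_rpow_eq_lintegral_measure_lt (hf : Measurable f) (hq : 0 < q) :
    ∫⁻ x, f x ^ q ∂μ = ENNReal.ofReal q *
      ∫⁻ l in Ioi (0 : ℝ), μ {x | ENNReal.ofReal l < f x} * ENNReal.ofReal (l ^ (q - 1)) := by
  have hpow (x : α) : f x ^ q = ⨆ n : ℕ, min (f x) n ^ q := by
    have h := (ENNReal.orderIsoRpow q hq).map_iSup fun n : ℕ => min (f x) (n : ℝ≥0∞)
    rwa [← inf_iSup_eq, ENNReal.iSup_natCast, inf_top_eq] at h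
  have hmeas (l : ℝ) : μ {x | ENNReal.ofReal l < f x} =
      ⨆ n : ℕ, μ {x | ENNReal.ofReal l < min (f x) n} := by
    have hmono : Monotone fun n : ℕ => {x | ENNReal.ofReal l < min (f x) n} :=
      fun m n hmn x hx => lt_of_lt_of_le (mem_ofPred.1 hx) (min_le_min_left _ (Nat.cast_le.2 hmn))
    rw [← hmono.measure_iUnion]
    congr 1
    ext x
    obtain ⟨n, hn⟩ := ENNReal.exists_nat_gt (ENNReal.ofReal_ne_top (r := l))
    simpa using fun _ => ⟨n, hn⟩
  have hanti (n : ℕ) : Antitone fun l : ℝ => μ {x | ENNReal.ofReal l < min (f x) n} :=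
    fun l l' hl => measure_mono fun x hx => (ENNReal.ofReal_le_ofReal hl).trans_lt hx
  have hrpow : Measurable fun l : ℝ => ENNReal.ofReal (l ^ (q - 1)) :=
    (measurable_id.pow_const _).ennreal_ofReal
  simp only [hpow, hmeas, ENNReal.iSup_mul]
  rw [lintegral_iSup (fun n => (hf.min measurable_const).pow_const q)
      fun m n hmn x => by dsimp only; gcongr,
    lintegral_iSup (fun n => (hanti n).measurable.fun_mul hrpow)
      fun m n hmn l => by dsimp only; gcongr, ENNReal.mul_iSup]
  exact iSup_congr fun n => lintegral_rpow_eq_lintegral_measure_lt_of_ne_top μ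
    (hf.min measurable_const) (fun x => (min_lt_of_right_lt (ENNReal.natCast_lt_top n)).ne) hq

theorem rpow_sub_one_mul_self (hq : 1 ≤ q) (x : ℝ≥0∞) : x ^ (q - 1) * x = x ^ q := by
  conv_rhs => rw [← sub_add_cancel q 1,
    ENNReal.rpow_add_of_nonneg _ _ (sub_nonneg.2 hq) zero_le_one, ENNReal.rpow_one]

theorem lintegral_rpow_sub_one_withDensity_self (hf : Measurable f) (hq : 1 ≤ q) :
    ∫⁻ x, f x ^ (q - 1) ∂μ.withDensity f = ∫⁻ x, f x ^ q ∂μ := by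
  rw [lintegral_withDensity_eq_lintegral_mul _ hf (hf.pow_const _)]
  simp only [Pi.mul_apply, mul_comm (f _), rpow_sub_one_mul_self hq]

end LayerCake

theorem exists_lintegral_intervalMaximal_rpow_le {p : ℝ} (hp : 1 < p) :
    ∃ C : ℝ≥0, ∀ (μ : Measure ℝ) (f : ℝ → ℝ≥0∞), Measurable f →
      ∫⁻ x, intervalMaximal μ f x ^ p ∂μ ≤ C * ∫⁻ x, f x ^ p ∂μ := by
  have hp0 : 0 < p := zero_lt_one.trans hp
  have hp1 : 0 < p - 1 := sub_pos.2 hp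
  refine ⟨(ENNReal.ofReal p * 4 * (ENNReal.ofReal (p - 1))⁻¹ * 2 ^ (p - 1)).toNNReal,
    fun μ f hf => ?_⟩
  rw [ENNReal.coe_toNNReal (by finiteness)]
  have hle {l : ℝ} (hl : 0 < l) :
      μ {x | ENNReal.ofReal l < intervalMaximal μ f x} * ENNReal.ofReal (l ^ (p - 1)) ≤
        4 * (μ.withDensity f {x | ENNReal.ofReal l < 2 * f x} *
          ENNReal.ofReal (l ^ (p - 1 - 1))) := by
    have hlp : ENNReal.ofReal (l ^ (p - 1)) =
        ENNReal.ofReal l * ENNReal.ofReal (l ^ (p - 1 - 1)) := by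
      rw [← ENNReal.ofReal_mul hl.le, mul_comm l, ← Real.rpow_add_one hl.ne', sub_add_cancel]
    rw [hlp, ← mul_assoc, ← mul_assoc, mul_comm (μ _),
      withDensity_apply _ (measurableSet_lt measurable_const (hf.const_mul 2))]
    gcongr ?_ * _
    exact mul_measure_lt_intervalMaximal_le_setLIntegral hf _
  have hlayer := lintegral_rpow_eq_lintegral_measure_lt (μ.withDensity f) (hf.const_mul 2) hp1
  calc ∫⁻ x, intervalMaximal μ f x ^ p ∂μ
      = ENNReal.ofReal p * ∫⁻ l in Ioi (0 : ℝ),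
          μ {x | ENNReal.ofReal l < intervalMaximal μ f x} * ENNReal.ofReal (l ^ (p - 1)) :=
        lintegral_rpow_eq_lintegral_measure_lt μ (measurable_intervalMaximal μ f) hp0
    _ ≤ ENNReal.ofReal p * ∫⁻ l in Ioi (0 : ℝ), 4 * (μ.withDensity f
          {x | ENNReal.ofReal l < 2 * f x} * ENNReal.ofReal (l ^ (p - 1 - 1))) := by
        gcongr 1
        exact setLIntegral_mono' measurableSet_Ioi fun l hl => hle hl
    _ = ENNReal.ofReal p * 4 * (ENNReal.ofReal (p - 1))⁻¹ *
          ∫⁻ x, (2 * f x) ^ (p - 1) ∂μ.withDensity f := by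
        rw [lintegral_const_mul' _ _ (by simp), hlayer, mul_assoc _ _ (_ * _),
          ENNReal.inv_mul_cancel_left (by simpa using hp) ENNReal.ofReal_ne_top, mul_assoc]
    _ = ENNReal.ofReal p * 4 * (ENNReal.ofReal (p - 1))⁻¹ * 2 ^ (p - 1) * ∫⁻ x, f x ^ p ∂μ := by
        simp only [ENNReal.mul_rpow_of_nonneg _ _ hp1.le]
        rw [lintegral_const_mul _ (hf.pow_const _),
          lintegral_rpow_sub_one_withDensity_self μ hf hp.le, mul_assoc _ (2 ^ (p - 1))]

/-! ### Muckenhoupt weights -/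

/-- A weight: a measurable function that is positive and finite almost everywhere. -/
structure IsWeight {α : Type*} [MeasurableSpace α] (μ : Measure α) (w : α → ℝ≥0∞) : Prop where
  measurable : Measurable w
  ae_ne_zero : ∀ᵐ x ∂μ, w x ≠ 0
  ae_ne_top : ∀ᵐ x ∂μ, w x ≠ ∞

namespace IsWeight

variable {α : Type*} [MeasurableSpace α] {μ : Measure α} {f v w : α → ℝ≥0∞}

theorem rpow (hw : IsWeight μ w) (r : ℝ) : IsWeight μ fun x => w x ^ r where
  measurable := hw.measurable.pow_const r
  ae_ne_zero := by
    filter_upwards [hw.ae_ne_zero, hw.ae_ne_top] with x h0 ht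
    simp [ENNReal.rpow_eq_zero_iff, h0, ht]
  ae_ne_top := by
    filter_upwards [hw.ae_ne_zero, hw.ae_ne_top] with x h0 ht
    simp [ENNReal.rpow_eq_top_iff, h0, ht]

theorem mul (hv : IsWeight μ v) (hw : IsWeight μ w) : IsWeight μ fun x => v x * w x where
  measurable := hv.measurable.mul hw.measurable
  ae_ne_zero := by
    filter_upwards [hv.ae_ne_zero, hw.ae_ne_zero] with x hvx hwx using mul_ne_zero hvx hwx
  ae_ne_top := by
    filter_upwards [hv.ae_ne_top, hw.ae_ne_top] with x hvx hwx using ENNReal.mul_ne_top hvx hwx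

theorem setLIntegral_ne_zero (hw : IsWeight μ w) {s : Set α} (hs : μ s ≠ 0) :
    ∫⁻ x in s, w x ∂μ ≠ 0 := by
  rw [Ne, lintegral_eq_zero_iff hw.measurable]
  intro h
  refine hs (Measure.restrict_eq_zero.1 (ae_eq_bot.1 (eventually_false_iff_eq_bot.1 ?_)))
  filter_upwards [h, ae_restrict_of_ae hw.ae_ne_zero] with x hx hx0 using hx0 hx

theorem lintegral_withDensity (hw : IsWeight μ w) (hf : Measurable f) :
    ∫⁻ x, f x ∂μ.withDensity w = ∫⁻ x, f x * w x ∂μ := by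
  rw [lintegral_withDensity_eq_lintegral_mul μ hw.measurable hf]
  simp only [Pi.mul_apply, mul_comm]

theorem setLIntegral_div_withDensity (hw : IsWeight μ w) (hf : Measurable f) {s : Set α}
    (hs : MeasurableSet s) : ∫⁻ x in s, f x / w x ∂μ.withDensity w = ∫⁻ x in s, f x ∂μ := by
  rw [setLIntegral_withDensity_eq_setLIntegral_mul μ hw.measurable (hf.fun_div hw.measurable) hs]
  refine lintegral_congr_ae (ae_restrict_of_ae ?_)
  filter_upwards [hw.ae_ne_zero, hw.ae_ne_top] with x h0 ht using ENNReal.mul_div_cancel h0 ht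

theorem lintegral_div_rpow_withDensity (hw : IsWeight μ w) (hf : Measurable f) {p : ℝ}
    (hp : 0 ≤ p) :
    ∫⁻ x, (f x / w x) ^ p ∂μ.withDensity w = ∫⁻ x, f x ^ p * w x ^ (1 - p) ∂μ := by
  rw [hw.lintegral_withDensity ((hf.fun_div hw.measurable).pow_const p)]
  refine lintegral_congr_ae ?_
  filter_upwards [hw.ae_ne_zero, hw.ae_ne_top] with x h0 ht
  rw [ENNReal.div_rpow_of_nonneg _ _ hp, div_eq_mul_inv, mul_assoc, ENNReal.rpow_sub _ _ h0 ht,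
    ENNReal.rpow_one, mul_comm (w x ^ p)⁻¹, ← div_eq_mul_inv]

end IsWeight

theorem IsWeight.setLIntegral_Icc_le {f w : ℝ → ℝ≥0∞} (hw : IsWeight volume w) (hf : Measurable f)
    {q : ℚ × ℚ} {x : ℝ} (hx : x ∈ Icc (q.1 : ℝ) q.2)
    (hwt : ∫⁻ y in Icc (q.1 : ℝ) q.2, w y ≠ ∞) :
    ∫⁻ y in Icc (q.1 : ℝ) q.2, f y ≤
      intervalMaximal (volume.withDensity w) (fun y => f y / w y) x *
        ∫⁻ y in Icc (q.1 : ℝ) q.2, w y := by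
  have h := setLIntegral_Icc_le_intervalMaximal_mul (μ := volume.withDensity w)
    (f := fun y => f y / w y) q hx (by rwa [withDensity_apply _ measurableSet_Icc])
  rwa [hw.setLIntegral_div_withDensity hf measurableSet_Icc,
    withDensity_apply _ measurableSet_Icc] at h

/-- `w` is an `A_p` weight on the line, `q` being the exponent conjugate to `p`. The constant is
normalised to be the same for `w` and for the dual weight `w ^ (1 - q)`: `K` bounds
`[w]_{A_p} ^ (1 / p)`. -/
structure IsApWeight (p q : ℝ) (K : ℝ≥0) (w : ℝ → ℝ≥0∞) : Prop extends IsWeight volume w where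
  bound : ∀ ⦃a b : ℝ⦄, a < b →
    (∫⁻ x in Icc a b, w x) ^ p⁻¹ * (∫⁻ x in Icc a b, w x ^ (1 - q)) ^ q⁻¹ ≤
      K * ENNReal.ofReal (b - a)

namespace IsApWeight

variable {p q : ℝ} {K : ℝ≥0} {w : ℝ → ℝ≥0∞} {a b : ℝ}

theorem dual (hpq : p.HolderConjugate q) (hw : IsApWeight p q K w) :
    IsApWeight q p K fun x => w x ^ (1 - q) where
  toIsWeight := hw.toIsWeight.rpow _
  bound a b hab := by
    have h : (1 - q) * (1 - p) = 1 := by linear_combination hpq.mul_eq_add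
    simp only [← ENNReal.rpow_mul, h, ENNReal.rpow_one]
    rw [mul_comm]
    exact hw.bound hab

theorem setLIntegral_ne_top (hpq : p.HolderConjugate q) (hw : IsApWeight p q K w) (hab : a < b) :
    ∫⁻ x in Icc a b, w x ≠ ∞ := by
  intro h
  have hb := hw.bound hab
  have h0 := (hw.toIsWeight.rpow (1 - q)).setLIntegral_ne_zero (s := Icc a b) (by simpa using hab)
  rw [h, ENNReal.top_rpow_of_pos (inv_pos.2 hpq.pos), ENNReal.top_mul] at hb
  · exact absurd (top_le_iff.1 hb) (by finiteness)
  · rwa [Ne, ENNReal.rpow_eq_zero_iff_of_pos (inv_pos.2 hpq.symm.pos)]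

theorem setLIntegral_mul_rpow_le (hpq : p.HolderConjugate q) (hw : IsApWeight p q K w)
    (hab : a < b) : (∫⁻ x in Icc a b, w x) * (∫⁻ x in Icc a b, w x ^ (1 - q)) ^ (p - 1) ≤
      K ^ p * ENNReal.ofReal (b - a) ^ p := by
  have h := ENNReal.rpow_le_rpow (hw.bound hab) hpq.pos.le
  have hqp : q⁻¹ * p = p - 1 := by rw [← hpq.div_conj_eq_sub_one, div_eq_inv_mul]
  rwa [ENNReal.mul_rpow_of_nonneg _ _ hpq.pos.le, ENNReal.mul_rpow_of_nonneg _ _ hpq.pos.le,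
    ← ENNReal.rpow_mul, ← ENNReal.rpow_mul, inv_mul_cancel₀ hpq.ne_zero, ENNReal.rpow_one,
    hqp] at h

/-- Lerner's pointwise bound: it reduces the weighted inequality to the unweighted ones for the
measures `w` and `w ^ (1 - q)`. -/
theorem intervalMaximal_rpow_le (hpq : p.HolderConjugate q) (hw : IsApWeight p q K w)
    {f : ℝ → ℝ≥0∞} (hf : Measurable f) (x : ℝ) :
    intervalMaximal volume f x ^ (p - 1) ≤
      K ^ p * intervalMaximal (volume.withDensity w) (fun z =>
        intervalMaximal (volume.withDensity fun y => w y ^ (1 - q))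
          (fun y => f y / w y ^ (1 - q)) z ^ (p - 1) / w z) x := by
  set A := intervalMaximal (volume.withDensity fun y => w y ^ (1 - q))
    (fun y => f y / w y ^ (1 - q))
  have hA : Measurable A := measurable_intervalMaximal _ _
  set B := intervalMaximal (volume.withDensity w) (fun z => A z ^ (p - 1) / w z)
  have hp1 := hpq.sub_one_pos
  rw [← ENNReal.le_rpow_inv_iff hp1]
  refine intervalMaximal_le_iff.2 fun r hx => ?_
  rw [ENNReal.le_rpow_inv_iff hp1]
  rcases (hx.1.trans hx.2).eq_or_lt with hr | hr
  · simp [← hr, hp1]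
  set I := Icc (r.1 : ℝ) r.2
  set d := ENNReal.ofReal (r.2 - r.1 : ℝ)
  have hd0 : d ≠ 0 := by simpa [d] using hr
  have hdt : d ≠ ∞ := ENNReal.ofReal_ne_top
  have hdI : volume I = d := Real.volume_Icc
  have hwt := hw.setLIntegral_ne_top hpq hr
  have hst := (hw.dual hpq).setLIntegral_ne_top hpq.symm hr
  rw [setLAverage_eq, hdI, ENNReal.div_rpow_of_nonneg _ _ hp1.le,
    ENNReal.div_le_iff (by positivity) (by finiteness), ← ENNReal.mul_le_mul_iff_left hd0 hdt]
  calc (∫⁻ y in I, f y) ^ (p - 1) * d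
      = ∫⁻ _ in I, (∫⁻ y in I, f y) ^ (p - 1) := by rw [setLIntegral_const, hdI]
    _ ≤ ∫⁻ z in I, A z ^ (p - 1) * (∫⁻ y in I, w y ^ (1 - q)) ^ (p - 1) := by
        refine setLIntegral_mono' measurableSet_Icc fun z hz => ?_
        rw [← ENNReal.mul_rpow_of_nonneg _ _ hp1.le]
        exact ENNReal.rpow_le_rpow ((hw.rpow (1 - q)).setLIntegral_Icc_le hf hz hst) hp1.le
    _ = (∫⁻ z in I, A z ^ (p - 1)) * (∫⁻ y in I, w y ^ (1 - q)) ^ (p - 1) :=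
        lintegral_mul_const _ (hA.pow_const _)
    _ ≤ B x * (∫⁻ y in I, w y) * (∫⁻ y in I, w y ^ (1 - q)) ^ (p - 1) := by
        gcongr
        exact hw.setLIntegral_Icc_le (hA.pow_const _) hx hwt
    _ ≤ B x * (K ^ p * d ^ p) := by
        rw [mul_assoc]
        gcongr B x * ?_
        exact hw.setLIntegral_mul_rpow_le hpq hr
    _ = K ^ p * B x * d ^ (p - 1) * d := by
        rw [← rpow_sub_one_mul_self hpq.lt.le d]
        ring

end IsApWeight

theorem exists_lintegral_intervalMaximal_rpow_mul_le {p q : ℝ} (hpq : p.HolderConjugate q)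
    (K : ℝ≥0) : ∃ C : ℝ≥0, ∀ w, IsApWeight p q K w → ∀ f : ℝ → ℝ≥0∞, Measurable f →
      ∫⁻ x, intervalMaximal volume f x ^ p * w x ≤ C * ∫⁻ x, f x ^ p * w x := by
  obtain ⟨C₁, hC₁⟩ := exists_lintegral_intervalMaximal_rpow_le hpq.lt
  obtain ⟨C₂, hC₂⟩ := exists_lintegral_intervalMaximal_rpow_le hpq.symm.lt
  refine ⟨(K ^ p) ^ q * C₂ * C₁, fun w hw f hf => ?_⟩
  have hs := hw.rpow (1 - q)
  set s : ℝ → ℝ≥0∞ := fun y => w y ^ (1 - q)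
  set A := intervalMaximal (volume.withDensity s) (fun y => f y / s y)
  have hA : Measurable A := measurable_intervalMaximal _ _
  set B := intervalMaximal (volume.withDensity w) (fun z => A z ^ (p - 1) / w z)
  have hB : Measurable B := measurable_intervalMaximal _ _
  have hpt (x : ℝ) : intervalMaximal volume f x ^ p ≤ ((K : ℝ≥0∞) ^ p) ^ q * B x ^ q := by
    have h := ENNReal.rpow_le_rpow (hw.intervalMaximal_rpow_le hpq hf x) hpq.symm.pos.le
    rwa [← ENNReal.rpow_mul, hpq.sub_one_mul_conj,
      ENNReal.mul_rpow_of_nonneg _ _ hpq.symm.pos.le] at h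
  calc ∫⁻ x, intervalMaximal volume f x ^ p * w x
      ≤ ∫⁻ x, (K ^ p) ^ q * (B x ^ q * w x) := by
        refine lintegral_mono fun x => ?_
        rw [← mul_assoc]
        gcongr
        exact hpt x
    _ = (K ^ p) ^ q * ∫⁻ x, B x ^ q ∂volume.withDensity w := by
        rw [hw.lintegral_withDensity (hB.pow_const q),
          lintegral_const_mul _ ((hB.pow_const q).fun_mul hw.measurable)]
    _ ≤ (K ^ p) ^ q * (C₂ * ∫⁻ x, (A x ^ (p - 1) / w x) ^ q ∂volume.withDensity w) := by
        gcongr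
        exact hC₂ _ _ ((hA.pow_const _).div hw.measurable)
    _ = (K ^ p) ^ q * (C₂ * ∫⁻ x, A x ^ p ∂volume.withDensity s) := by
        rw [hw.lintegral_div_rpow_withDensity (hA.pow_const _) hpq.symm.pos.le,
          hs.lintegral_withDensity (hA.pow_const p)]
        simp only [← ENNReal.rpow_mul, hpq.sub_one_mul_conj, s]
    _ ≤ (K ^ p) ^ q * (C₂ * (C₁ * ∫⁻ x, (f x / s x) ^ p ∂volume.withDensity s)) := by
        gcongr
        exact hC₁ _ _ (hf.div hs.measurable)
    _ = (K ^ p) ^ q * (C₂ * (C₁ * ∫⁻ x, f x ^ p * w x)) := by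
        have h : (1 - q) * (1 - p) = 1 := by linear_combination hpq.mul_eq_add
        rw [hs.lintegral_div_rpow_withDensity hf hpq.pos.le]
        simp only [s, ← ENNReal.rpow_mul, h, ENNReal.rpow_one]
    _ = ((K ^ p) ^ q * C₂ * C₁ : ℝ≥0) * ∫⁻ x, f x ^ p * w x := by
        push_cast [ENNReal.coe_rpow_of_nonneg _ hpq.pos.le,
          ENNReal.coe_rpow_of_nonneg _ hpq.symm.pos.le]
        ring

/-! ### Factored weights -/

theorem setLIntegral_Icc_le_intervalMaximal_volume_mul (f : ℝ → ℝ≥0∞) {a b x : ℝ}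
    (hx : x ∈ Icc a b) :
    ∫⁻ y in Icc a b, f y ≤ intervalMaximal volume f x * ENNReal.ofReal (b - a) := by
  obtain ⟨u, -, hua, hu⟩ := Real.exists_seq_rat_strictMono_tendsto a
  obtain ⟨v, -, hvb, hv⟩ := Real.exists_seq_rat_strictAnti_tendsto b
  rcases (hx.1.trans hx.2).eq_or_lt with rfl | hab
  · simp
  have hlim : Tendsto (fun n => intervalMaximal volume f x * ENNReal.ofReal (v n - u n)) atTop
      (𝓝 (intervalMaximal volume f x * ENNReal.ofReal (b - a))) :=
    ENNReal.Tendsto.const_mul (ENNReal.tendsto_ofReal (hv.sub hu)) (Or.inl (by simpa using hab))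
  refine ge_of_tendsto' hlim fun n => ?_
  calc ∫⁻ y in Icc a b, f y ≤ ∫⁻ y in Icc (u n : ℝ) (v n), f y :=
        lintegral_mono_set (Icc_subset_Icc (hua n).le (hvb n).le)
    _ ≤ intervalMaximal volume f x * ENNReal.ofReal (v n - u n) := by
        have h := setLIntegral_Icc_le_intervalMaximal_mul (μ := volume) (f := f) (u n, v n)
          ⟨(hua n).le.trans hx.1, hx.2.trans (hvb n).le⟩ (by simp)
        rwa [Real.volume_Icc] at h

theorem intervalMaximal_volume_ne_zero {f : ℝ → ℝ≥0∞} (hf : Measurable f)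
    (hne : ¬ ∀ᵐ x, f x = 0) (x : ℝ) : intervalMaximal volume f x ≠ 0 := by
  intro hx
  refine hne ?_
  rw [← Measure.restrict_univ (μ := volume), ← Metric.iUnion_closedBall_nat x,
    ae_restrict_iUnion_iff]
  intro n
  have h := setLIntegral_Icc_le_intervalMaximal_volume_mul f (a := x - n) (b := x + n) (x := x)
    ⟨by simp, by simp⟩
  rw [hx, zero_mul, nonpos_iff_eq_zero, lintegral_eq_zero_iff hf] at h
  rwa [Real.closedBall_eq_Icc]

/-- `u` is an `A₁` weight on the line with constant `K`, the defining inequality holding at every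
point and not only almost everywhere. -/
structure IsAOneWeight (K : ℝ≥0) (u : ℝ → ℝ≥0∞) : Prop extends IsWeight volume u where
  intervalMaximal_le : ∀ x, intervalMaximal volume u x ≤ K * u x

theorem IsAOneWeight.exists_le_setLIntegral_le {K : ℝ≥0} {u : ℝ → ℝ≥0∞} (hu : IsAOneWeight K u)
    {a b : ℝ} (hab : a < b) : ∃ c : ℝ≥0∞, c ≠ 0 ∧ c ≠ ∞ ∧ (∀ x ∈ Icc a b, c ≤ u x) ∧
      ∫⁻ x in Icc a b, u x ≤ K * ENNReal.ofReal (b - a) * c := by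
  have hle : ∫⁻ x in Icc a b, u x ≤ K * ENNReal.ofReal (b - a) * ⨅ x : Icc a b, u x := by
    have : Nonempty (Icc a b) := ⟨a, left_mem_Icc.2 hab.le⟩
    rw [ENNReal.mul_iInf fun h => absurd h (by finiteness)]
    refine le_iInf fun x => (setLIntegral_Icc_le_intervalMaximal_volume_mul u x.2).trans ?_
    rw [mul_right_comm]
    gcongr
    exact hu.intervalMaximal_le x
  have hI : volume (Icc a b) ≠ 0 := by simpa using hab
  refine ⟨_, fun h0 => ?_, fun ht => ?_, fun x hx => iInf_le (fun y : Icc a b => u y) ⟨x, hx⟩, hle⟩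
  · rw [h0, mul_zero, nonpos_iff_eq_zero] at hle
    exact hu.setLIntegral_ne_zero hI hle
  · refine hI (Measure.restrict_eq_zero.1 (ae_eq_bot.1 (eventually_false_iff_eq_bot.1 ?_)))
    filter_upwards [ae_restrict_mem measurableSet_Icc, ae_restrict_of_ae hu.ae_ne_top] with x hx hxt
    exact hxt (iInf_eq_top.1 ht ⟨x, hx⟩)

theorem rpow_le_rpow_of_nonpos {r : ℝ} (hr : r ≤ 0) {a b : ℝ≥0∞} (h : a ≤ b) : b ^ r ≤ a ^ r := by
  rw [← neg_neg r, ENNReal.rpow_neg _ (-r), ENNReal.rpow_neg _ (-r), ENNReal.inv_le_inv]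
  exact ENNReal.rpow_le_rpow h (neg_nonneg.2 hr)

theorem setLIntegral_mul_rpow_le_of_nonpos {α : Type*} [MeasurableSpace α] {μ : Measure α}
    {u v : α → ℝ≥0∞} {r : ℝ} (hr : r ≤ 0) {s : Set α} (hs : MeasurableSet s) (hu : Measurable u)
    {A e : ℝ≥0∞} (huA : ∫⁻ x in s, u x ∂μ ≤ A) (hev : ∀ x ∈ s, e ≤ v x) :
    ∫⁻ x in s, u x * v x ^ r ∂μ ≤ A * e ^ r := by
  calc ∫⁻ x in s, u x * v x ^ r ∂μ ≤ ∫⁻ x in s, u x * e ^ r ∂μ :=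
        setLIntegral_mono' hs fun x hx => mul_le_mul_right (rpow_le_rpow_of_nonpos hr (hev x hx)) _
    _ = (∫⁻ x in s, u x ∂μ) * e ^ r := lintegral_mul_const _ hu
    _ ≤ A * e ^ r := mul_le_mul_left huA _

theorem IsWeight.mul_rpow_rpow_ae_eq {α : Type*} [MeasurableSpace α] {μ : Measure α}
    {p q : ℝ} (hpq : p.HolderConjugate q) {u v : α → ℝ≥0∞} (hu : IsWeight μ u) (hv : IsWeight μ v) :
    (fun x => (u x * v x ^ (1 - p)) ^ (1 - q)) =ᵐ[μ] fun x => v x * u x ^ (1 - q) := by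
  filter_upwards [hu.ae_ne_top, (hv.rpow (1 - p)).ae_ne_top] with x hux hvx
  have h : (1 - p) * (1 - q) = 1 := by linear_combination hpq.mul_eq_add
  rw [ENNReal.mul_rpow_of_ne_top hux hvx, ← ENNReal.rpow_mul, h, ENNReal.rpow_one, mul_comm]

theorem IsAOneWeight.mul_rpow {p q : ℝ} (hpq : p.HolderConjugate q) {K L : ℝ≥0}
    {u v : ℝ → ℝ≥0∞} (hu : IsAOneWeight K u) (hv : IsAOneWeight L v) :
    IsApWeight p q (K ^ p⁻¹ * L ^ q⁻¹) fun x => u x * v x ^ (1 - p) where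
  toIsWeight := hu.toIsWeight.mul (hv.toIsWeight.rpow _)
  bound a b hab := by
    have hp' := inv_pos.2 hpq.pos
    have hq' := inv_pos.2 hpq.symm.pos
    obtain ⟨c, hc0, hct, hcu, hc⟩ := hu.exists_le_setLIntegral_le hab
    obtain ⟨e, he0, het, hev, he⟩ := hv.exists_le_setLIntegral_le hab
    set d := ENNReal.ofReal (b - a)
    have hpow {x : ℝ≥0∞} (h0 : x ≠ 0) (ht : x ≠ ∞) {r s : ℝ} (hrs : r + s = 0) :
        x ^ r * x ^ s = 1 := by rw [← ENNReal.rpow_add _ _ h0 ht, hrs, ENNReal.rpow_zero]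
    rw [lintegral_congr_ae (ae_restrict_of_ae
      (hu.toIsWeight.mul_rpow_rpow_ae_eq hpq hv.toIsWeight))]
    calc (∫⁻ x in Icc a b, u x * v x ^ (1 - p)) ^ p⁻¹ *
          (∫⁻ x in Icc a b, v x * u x ^ (1 - q)) ^ q⁻¹
        ≤ (K * d * c * e ^ (1 - p)) ^ p⁻¹ * (L * d * e * c ^ (1 - q)) ^ q⁻¹ := by
          gcongr
          · exact setLIntegral_mul_rpow_le_of_nonpos (sub_nonpos.2 hpq.lt.le) measurableSet_Icc
              hu.measurable hc hev
          · exact setLIntegral_mul_rpow_le_of_nonpos (sub_nonpos.2 hpq.symm.lt.le) measurableSet_Icc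
              hv.measurable he hcu
      _ = K ^ p⁻¹ * L ^ q⁻¹ * (d ^ p⁻¹ * d ^ q⁻¹) * (c ^ p⁻¹ * c ^ ((1 - q) * q⁻¹)) *
            (e ^ q⁻¹ * e ^ ((1 - p) * p⁻¹)) := by
          simp only [ENNReal.mul_rpow_of_nonneg _ _ hp'.le, ENNReal.mul_rpow_of_nonneg _ _ hq'.le,
            ← ENNReal.rpow_mul]
          ring
      _ = (K ^ p⁻¹ * L ^ q⁻¹ : ℝ≥0) * d := by
          rw [hpow hc0 hct, hpow he0 het, ← ENNReal.rpow_add_of_nonneg _ _ hp'.le hq'.le,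
            hpq.inv_add_inv_eq_one, ENNReal.rpow_one, mul_one, mul_one, ENNReal.coe_mul,
            ENNReal.coe_rpow_of_nonneg _ hp'.le, ENNReal.coe_rpow_of_nonneg _ hq'.le]
          · rw [sub_mul, mul_inv_cancel₀ hpq.ne_zero]
            linear_combination hpq.inv_add_inv_eq_one
          · rw [sub_mul, mul_inv_cancel₀ hpq.symm.ne_zero]
            linear_combination hpq.inv_add_inv_eq_one

theorem isApWeight_one {p q : ℝ} (hpq : p.HolderConjugate q) : IsApWeight p q 1 fun _ => 1 where
  measurable := measurable_const
  ae_ne_zero := by simp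
  ae_ne_top := by simp
  bound a b _ := by
    have h := ENNReal.rpow_add_of_nonneg (x := ENNReal.ofReal (b - a)) _ _
      (inv_pos.2 hpq.pos).le (inv_pos.2 hpq.symm.pos).le
    rw [hpq.inv_add_inv_eq_one, ENNReal.rpow_one] at h
    simp [← h]

/-! ### Majorants of Rubio de Francia -/

section Majorant

theorem intervalMaximal_tsum_mul_le (μ : Measure ℝ) {F : ℕ → ℝ → ℝ≥0∞}
    (hF : ∀ k, Measurable (F k)) (c : ℕ → ℝ≥0∞) (x : ℝ) :
    intervalMaximal μ (fun y => ∑' k, c k * F k y) x ≤ ∑' k, c k * intervalMaximal μ (F k) x := by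
  refine intervalMaximal_le_iff.2 fun q hx => ?_
  rw [setLAverage_eq, lintegral_tsum fun k => ((hF k).const_mul _).aemeasurable, div_eq_mul_inv,
    ← ENNReal.tsum_mul_right]
  refine ENNReal.tsum_le_tsum fun k => ?_
  rw [lintegral_const_mul _ (hF k), mul_assoc, ← div_eq_mul_inv, ← setLAverage_eq]
  gcongr
  exact setLAverage_le_intervalMaximal q hx

theorem rpow_tsum_mul_le {p : ℝ} (hp : 1 ≤ p) (w z : ℕ → ℝ≥0∞) :
    (∑' k, w k * z k) ^ p ≤ (∑' k, w k) ^ (p - 1) * ∑' k, w k * z k ^ p := by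
  have hp0 : 0 < p := zero_lt_one.trans_le hp
  have hp' : 0 ≤ 1 - p⁻¹ := sub_nonneg.2 (inv_le_one_of_one_le₀ hp)
  have h : ∑' k, w k * z k ≤ (∑' k, w k) ^ (1 - p⁻¹) * (∑' k, w k * z k ^ p) ^ p⁻¹ := by
    rw [ENNReal.tsum_eq_iSup_sum]
    refine iSup_le fun s => (ENNReal.inner_le_weight_mul_Lp_of_nonneg s hp w z).trans ?_
    gcongr <;> exact ENNReal.sum_le_tsum s
  refine (ENNReal.rpow_le_rpow h hp0.le).trans_eq ?_
  rw [ENNReal.mul_rpow_of_nonneg _ _ hp0.le, ← ENNReal.rpow_mul, ← ENNReal.rpow_mul, sub_mul,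
    one_mul, inv_mul_cancel₀ hp0.ne', ENNReal.rpow_one]

/-- The Rubio de Francia majorant of `h`, an `A₁` weight. In its use `N` is a bound for the norm of
the maximal operator on a weighted `L^p` space. -/
noncomputable def rubioDeFrancia (N : ℝ≥0) (h : ℝ → ℝ≥0∞) (x : ℝ) : ℝ≥0∞ :=
  ∑' k, (2 * N : ℝ≥0∞)⁻¹ ^ k * (intervalMaximal volume)^[k] h x

variable {N : ℝ≥0} {h w : ℝ → ℝ≥0∞}

theorem measurable_iterate_intervalMaximal (hh : Measurable h) (k : ℕ) :
    Measurable ((intervalMaximal volume)^[k] h) := by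
  cases k with
  | zero => exact hh
  | succ k =>
    rw [Function.iterate_succ_apply']
    exact measurable_intervalMaximal _ _

theorem measurable_rubioDeFrancia (hh : Measurable h) : Measurable (rubioDeFrancia N h) :=
  .tsum fun k => (measurable_iterate_intervalMaximal hh k).const_mul _

theorem le_rubioDeFrancia (x : ℝ) : h x ≤ rubioDeFrancia N h x := by
  calc h x = (2 * N : ℝ≥0∞)⁻¹ ^ 0 * (intervalMaximal volume)^[0] h x := by simp
    _ ≤ rubioDeFrancia N h x := ENNReal.le_tsum _

theorem intervalMaximal_rubioDeFrancia_le (hN : N ≠ 0) (hh : Measurable h) (x : ℝ) :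
    intervalMaximal volume (rubioDeFrancia N h) x ≤ (2 * N : ℝ≥0) * rubioDeFrancia N h x := by
  have hc0 : (2 * N : ℝ≥0∞) ≠ 0 := by simpa using hN
  have hct : (2 * N : ℝ≥0∞) ≠ ∞ := by finiteness
  calc intervalMaximal volume (rubioDeFrancia N h) x
      ≤ ∑' k, (2 * N : ℝ≥0∞)⁻¹ ^ k *
          intervalMaximal volume ((intervalMaximal volume)^[k] h) x :=
        intervalMaximal_tsum_mul_le _ (measurable_iterate_intervalMaximal hh) _ x
    _ = ∑' k, 2 * N * ((2 * N : ℝ≥0∞)⁻¹ ^ (k + 1) * (intervalMaximal volume)^[k + 1] h x) := by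
        refine tsum_congr fun k => ?_
        rw [Function.iterate_succ_apply', pow_succ', ← mul_assoc, ← mul_assoc,
          ENNReal.mul_inv_cancel hc0 hct, one_mul]
    _ ≤ (2 * N : ℝ≥0) * rubioDeFrancia N h x := by
        rw [ENNReal.tsum_mul_left, ENNReal.coe_mul, ENNReal.coe_ofNat]
        gcongr
        exact ENNReal.tsum_comp_le_tsum_of_injective (add_left_injective 1)
          fun k => (2 * N : ℝ≥0∞)⁻¹ ^ k * (intervalMaximal volume)^[k] h x

theorem isAOneWeight_rubioDeFrancia (hN : N ≠ 0) (hh : Measurable h) (hne : ¬ ∀ᵐ x, h x = 0)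
    (htop : ∀ᵐ x, rubioDeFrancia N h x ≠ ∞) : IsAOneWeight (2 * N) (rubioDeFrancia N h) where
  measurable := measurable_rubioDeFrancia hh
  ae_ne_zero := by
    refine .of_forall fun x hx => intervalMaximal_volume_ne_zero
      (measurable_rubioDeFrancia (N := N) hh) (fun h0 => hne ?_) x ?_
    · filter_upwards [h0] with y hy using nonpos_iff_eq_zero.1 (hy ▸ le_rubioDeFrancia y)
    · simpa only [hx, mul_zero, nonpos_iff_eq_zero] using intervalMaximal_rubioDeFrancia_le hN hh x
  ae_ne_top := htop
  intervalMaximal_le := intervalMaximal_rubioDeFrancia_le hN hh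

theorem lintegral_iterate_intervalMaximal_rpow_mul_le {p : ℝ} {C : ℝ≥0∞} (hh : Measurable h)
    (hC : ∀ f : ℝ → ℝ≥0∞, Measurable f →
      ∫⁻ x, intervalMaximal volume f x ^ p * w x ≤ C * ∫⁻ x, f x ^ p * w x) (k : ℕ) :
    ∫⁻ x, (intervalMaximal volume)^[k] h x ^ p * w x ≤ C ^ k * ∫⁻ x, h x ^ p * w x := by
  induction k with
  | zero => simp
  | succ k ih =>
    simp only [Function.iterate_succ_apply']
    rw [pow_succ', mul_assoc]
    exact (hC _ (measurable_iterate_intervalMaximal hh k)).trans (mul_le_mul_right ih _)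

theorem rubioDeFrancia_rpow_le {p : ℝ} (hp : 1 ≤ p) (x : ℝ) :
    rubioDeFrancia N h x ^ p ≤
      2 ^ (p - 1) *
        ∑' k, 2⁻¹ ^ k * ((N ^ p : ℝ≥0∞)⁻¹ ^ k * (intervalMaximal volume)^[k] h x ^ p) := by
  have hp0 : 0 ≤ p := zero_le_one.trans hp
  have hR : rubioDeFrancia N h x =
      ∑' k, (2⁻¹ : ℝ≥0∞) ^ k * ((N : ℝ≥0∞)⁻¹ ^ k * (intervalMaximal volume)^[k] h x) := by
    refine tsum_congr fun k => ?_
    rw [ENNReal.mul_inv (by simp) (by simp), mul_pow, mul_assoc]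
  rw [hR]
  refine (rpow_tsum_mul_le hp _ _).trans_eq ?_
  rw [ENNReal.tsum_geometric_two]
  congr! 5 with k
  rw [ENNReal.mul_rpow_of_nonneg _ _ hp0, ← ENNReal.inv_rpow, ← ENNReal.rpow_natCast,
    ← ENNReal.rpow_natCast, ← ENNReal.rpow_mul, ← ENNReal.rpow_mul, mul_comm p]

theorem lintegral_rubioDeFrancia_rpow_mul_le {p : ℝ} (hp : 1 ≤ p) (hN : N ≠ 0)
    (hh : Measurable h) (hw : Measurable w) (hC : ∀ f : ℝ → ℝ≥0∞, Measurable f →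
      ∫⁻ x, intervalMaximal volume f x ^ p * w x ≤ N ^ p * ∫⁻ x, f x ^ p * w x) :
    ∫⁻ x, rubioDeFrancia N h x ^ p * w x ≤ 2 ^ p * ∫⁻ x, h x ^ p * w x := by
  have hN0 : (N : ℝ≥0∞) ^ p ≠ 0 := by simp [hN]
  have hNt : (N : ℝ≥0∞) ^ p ≠ ∞ := by finiteness
  have hF (k : ℕ) : Measurable fun x => (intervalMaximal volume)^[k] h x ^ p * w x :=
    ((measurable_iterate_intervalMaximal hh k).pow_const p).mul hw
  calc ∫⁻ x, rubioDeFrancia N h x ^ p * w x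
      ≤ ∫⁻ x, 2 ^ (p - 1) * ∑' k, (2⁻¹ * (N ^ p : ℝ≥0∞)⁻¹) ^ k *
          ((intervalMaximal volume)^[k] h x ^ p * w x) := by
        refine lintegral_mono fun x => (mul_le_mul_left (rubioDeFrancia_rpow_le hp x) _).trans_eq ?_
        rw [mul_assoc, ← ENNReal.tsum_mul_right]
        simp only [mul_pow, mul_assoc]
    _ = 2 ^ (p - 1) * ∑' k, (2⁻¹ * (N ^ p : ℝ≥0∞)⁻¹) ^ k *
          ∫⁻ x, (intervalMaximal volume)^[k] h x ^ p * w x := by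
        rw [lintegral_const_mul _ (.tsum fun k => (hF k).const_mul _),
          lintegral_tsum fun k => ((hF k).const_mul _).aemeasurable]
        simp only [lintegral_const_mul _ (hF _)]
    _ ≤ 2 ^ (p - 1) * ∑' k, (2⁻¹ * (N ^ p : ℝ≥0∞)⁻¹) ^ k * ((N ^ p) ^ k * ∫⁻ x, h x ^ p * w x) := by
        gcongr with k
        exact lintegral_iterate_intervalMaximal_rpow_mul_le hh hC k
    _ = 2 ^ (p - 1) * ∑' k, 2⁻¹ ^ k * ∫⁻ x, h x ^ p * w x := by
        simp only [← mul_assoc, ← mul_pow, mul_assoc (2⁻¹ : ℝ≥0∞), ENNReal.inv_mul_cancel hN0 hNt,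
          mul_one]
    _ = 2 ^ p * ∫⁻ x, h x ^ p * w x := by
        rw [ENNReal.tsum_mul_right, ENNReal.tsum_geometric_two, ← mul_assoc,
          rpow_sub_one_mul_self hp]

end Majorant

theorem exists_isAOneWeight_majorant {p q : ℝ} (hpq : p.HolderConjugate q) (K : ℝ≥0) :
    ∃ L : ℝ≥0, ∀ w, IsApWeight p q K w → ∀ h : ℝ → ℝ≥0∞, Measurable h →
      ∫⁻ x, h x ^ p * w x ≠ ∞ → (¬ ∀ᵐ x, h x = 0) →
      ∃ H, IsAOneWeight L H ∧ (∀ x, h x ≤ H x) ∧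
        ∫⁻ x, H x ^ p * w x ≤ 2 ^ p * ∫⁻ x, h x ^ p * w x := by
  have hp0 := hpq.pos
  obtain ⟨C, hC⟩ := exists_lintegral_intervalMaximal_rpow_mul_le hpq K
  set N : ℝ≥0 := C ^ p⁻¹ + 1
  have hN : N ≠ 0 := by positivity
  have hCN : (C : ℝ≥0∞) ≤ N ^ p := by
    rw [← ENNReal.coe_rpow_of_nonneg _ hp0.le, ENNReal.coe_le_coe, ← NNReal.rpow_inv_le_iff hp0]
    exact le_self_add
  refine ⟨2 * N, fun w hw h hh hfin hne => ?_⟩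
  have hnorm := lintegral_rubioDeFrancia_rpow_mul_le hpq.lt.le hN hh hw.measurable
    fun f hf => (hC w hw f hf).trans (mul_le_mul_left hCN _)
  have hlt := ae_lt_top (((measurable_rubioDeFrancia hh).pow_const p).mul hw.measurable)
    (ne_top_of_le_ne_top (ENNReal.mul_ne_top (by finiteness) hfin) hnorm)
  refine ⟨_, isAOneWeight_rubioDeFrancia hN hh hne ?_, le_rubioDeFrancia, hnorm⟩
  filter_upwards [hlt, hw.ae_ne_zero] with x hx hx0 hRx
  simp [hRx, hp0, hx0] at hx

/-! ### Extrapolation -/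

section Duality

variable {α : Type*} [MeasurableSpace α] {μ : Measure α} {p q : ℝ} {w U V : α → ℝ≥0∞}

theorem le_add_rpow_mul_rpow (hp : 1 ≤ p) {a b : ℝ≥0∞} (hb0 : b ≠ 0) (hbt : b ≠ ∞) :
    a ≤ b + a ^ p * b ^ (1 - p) := by
  rcases le_total a b with h | h
  · exact le_add_right h
  · refine le_add_left ?_
    calc a = a * (b ^ (p - 1) * b ^ (1 - p)) := by simp [← ENNReal.rpow_add _ _ hb0 hbt]
      _ ≤ a * (a ^ (p - 1) * b ^ (1 - p)) := by
          gcongr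
      _ = a ^ p * b ^ (1 - p) := by
          rw [← rpow_sub_one_mul_self hp a]
          ring

theorem lintegral_mul_le_one_add_mul (hp : 1 ≤ p) (hU : IsWeight μ U) (hV : Measurable V)
    {f g : α → ℝ≥0∞} (hgU : ∀ x, g x ≤ U x) {C : ℝ≥0∞}
    (hC : ∫⁻ x, f x ^ p * (V x * U x ^ (1 - p)) ∂μ ≤
      C * ∫⁻ x, g x ^ p * (V x * U x ^ (1 - p)) ∂μ) :
    ∫⁻ x, f x * V x ∂μ ≤ (1 + C) * ∫⁻ x, U x * V x ∂μ := by
  calc ∫⁻ x, f x * V x ∂μ ≤ ∫⁻ x, U x * V x + f x ^ p * (V x * U x ^ (1 - p)) ∂μ := by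
        refine lintegral_mono_ae ?_
        filter_upwards [hU.ae_ne_zero, hU.ae_ne_top] with x h0 ht
        calc f x * V x ≤ (U x + f x ^ p * U x ^ (1 - p)) * V x :=
              mul_le_mul_left (le_add_rpow_mul_rpow hp h0 ht) _
          _ = U x * V x + f x ^ p * (V x * U x ^ (1 - p)) := by ring
    _ = ∫⁻ x, U x * V x ∂μ + ∫⁻ x, f x ^ p * (V x * U x ^ (1 - p)) ∂μ :=
        lintegral_add_left (hU.measurable.mul hV) _
    _ ≤ ∫⁻ x, U x * V x ∂μ + C * ∫⁻ x, U x * V x ∂μ := by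
        refine add_le_add_right (hC.trans (mul_le_mul_right (lintegral_mono_ae ?_) _)) _
        filter_upwards [hU.ae_ne_zero, hU.ae_ne_top] with x h0 ht
        calc g x ^ p * (V x * U x ^ (1 - p)) ≤ U x ^ p * (V x * U x ^ (1 - p)) := by
              gcongr
              exact hgU x
          _ = (U x ^ p * U x ^ (1 - p)) * V x := by ring
          _ = U x * V x := by simp [← ENNReal.rpow_add _ _ h0 ht]
    _ = (1 + C) * ∫⁻ x, U x * V x ∂μ := by rw [add_mul, one_mul]

theorem IsWeight.lintegral_mul_le_Lp_mul_Lq (hw : IsWeight μ w) (hpq : p.HolderConjugate q)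
    (hU : Measurable U) (hV : Measurable V) :
    ∫⁻ x, U x * V x ∂μ ≤
      (∫⁻ x, U x ^ p * w x ∂μ) ^ p⁻¹ * (∫⁻ x, V x ^ q * w x ^ (1 - q) ∂μ) ^ q⁻¹ := by
  have hwm := hw.measurable
  have hexp : -p⁻¹ * q = 1 - q := by
    rw [neg_mul, ← div_eq_inv_mul, hpq.symm.div_conj_eq_sub_one, neg_sub]
  have h := ENNReal.lintegral_mul_le_Lp_mul_Lq μ hpq
    (f := fun x => U x * w x ^ p⁻¹) (g := fun x => V x * w x ^ (-p⁻¹)) (by fun_prop) (by fun_prop)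
  simp only [Pi.mul_apply, ENNReal.mul_rpow_of_nonneg _ _ hpq.pos.le,
    ENNReal.mul_rpow_of_nonneg _ _ hpq.symm.pos.le, ← ENNReal.rpow_mul, hexp, one_div,
    inv_mul_cancel₀ hpq.ne_zero, ENNReal.rpow_one] at h
  refine (lintegral_mono_ae ?_).trans h
  filter_upwards [hw.ae_ne_zero, hw.ae_ne_top] with x h0 ht
  calc U x * V x = U x * V x * (w x ^ p⁻¹ * w x ^ (-p⁻¹)) := by simp [← ENNReal.rpow_add _ _ h0 ht]
    _ ≤ U x * w x ^ p⁻¹ * (V x * w x ^ (-p⁻¹)) := by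
        rw [mul_mul_mul_comm]

theorem IsWeight.lintegral_rpow_sub_one_mul_rpow (hw : IsWeight μ w) (hpq : p.HolderConjugate q)
    (F : α → ℝ≥0∞) :
    ∫⁻ x, (F x ^ (p - 1) * w x) ^ q * w x ^ (1 - q) ∂μ = ∫⁻ x, F x ^ p * w x ∂μ := by
  refine lintegral_congr_ae ?_
  filter_upwards [hw.ae_ne_zero, hw.ae_ne_top] with x h0 ht
  rw [ENNReal.mul_rpow_of_nonneg _ _ hpq.symm.pos.le, ← ENNReal.rpow_mul, hpq.sub_one_mul_conj,
    mul_assoc, ← ENNReal.rpow_add _ _ h0 ht, add_sub_cancel, ENNReal.rpow_one]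

theorem le_rpow_of_le_mul_rpow_inv (hpq : p.HolderConjugate q) {A I : ℝ≥0∞} (hI : I ≠ ∞)
    (h : I ≤ A * I ^ q⁻¹) : I ≤ A ^ p := by
  rcases eq_or_ne I 0 with rfl | hI0
  · exact zero_le
  have hsplit : I ^ p⁻¹ * I ^ q⁻¹ = I := by
    rw [← ENNReal.rpow_add _ _ hI0 hI, hpq.inv_add_inv_eq_one, ENNReal.rpow_one]
  rw [← ENNReal.rpow_inv_le_iff hpq.pos]
  nth_rewrite 1 [← hsplit] at h
  exact (ENNReal.mul_le_mul_iff_left (ENNReal.rpow_pos (pos_iff_ne_zero.2 hI0) hI).ne'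
    (ENNReal.rpow_ne_top_of_ne_zero hI0 hI)).1 h

theorem IsWeight.lintegral_rpow_mul_le_of_lintegral_mul_le (hw : IsWeight μ w)
    (hpq : p.HolderConjugate q) (hU : Measurable U) (hV : Measurable V) {F : α → ℝ≥0∞}
    {D G : ℝ≥0∞} (hF : ∫⁻ x, F x ^ p * w x ∂μ ≠ ∞) (hFV : ∀ x, F x ^ (p - 1) * w x ≤ V x)
    (hUV : ∫⁻ x, F x * V x ∂μ ≤ D * ∫⁻ x, U x * V x ∂μ)
    (hUG : ∫⁻ x, U x ^ p * w x ∂μ ≤ 2 ^ p * G)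
    (hVF : ∫⁻ x, V x ^ q * w x ^ (1 - q) ∂μ ≤ 2 ^ q * ∫⁻ x, F x ^ p * w x ∂μ) :
    ∫⁻ x, F x ^ p * w x ∂μ ≤ (4 * D) ^ p * G := by
  set I := ∫⁻ x, F x ^ p * w x ∂μ
  have h : I ≤ 4 * D * G ^ p⁻¹ * I ^ q⁻¹ := by
    calc I ≤ ∫⁻ x, F x * V x ∂μ := by
          refine lintegral_mono fun x => ?_
          rw [← rpow_sub_one_mul_self hpq.lt.le, mul_comm (_ ^ _), mul_assoc]
          exact mul_le_mul_right (hFV x) _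
      _ ≤ D * ((2 ^ p * G) ^ p⁻¹ * (2 ^ q * I) ^ q⁻¹) := by
          refine hUV.trans (mul_le_mul_right ?_ _)
          refine (hw.lintegral_mul_le_Lp_mul_Lq hpq hU hV).trans ?_
          gcongr
          · exact (inv_pos.2 hpq.pos).le
          · exact (inv_pos.2 hpq.symm.pos).le
      _ = 4 * D * G ^ p⁻¹ * I ^ q⁻¹ := by
          rw [ENNReal.mul_rpow_of_nonneg _ _ (inv_pos.2 hpq.pos).le,
            ENNReal.mul_rpow_of_nonneg _ _ (inv_pos.2 hpq.symm.pos).le,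
            ENNReal.rpow_rpow_inv hpq.ne_zero, ENNReal.rpow_rpow_inv hpq.symm.ne_zero]
          ring
  refine (le_rpow_of_le_mul_rpow_inv hpq hF h).trans_eq ?_
  rw [ENNReal.mul_rpow_of_nonneg _ _ hpq.pos.le, ENNReal.rpow_inv_rpow hpq.ne_zero]

theorem lintegral_le_of_forall_le_of_ne_top [SigmaFinite μ] {f : α → ℝ≥0∞} {C : ℝ≥0∞}
    (h : ∀ g : α → ℝ≥0∞, Measurable g → (∀ x, g x ≤ f x) → ∫⁻ x, g x ∂μ ≠ ∞ →
      ∫⁻ x, g x ∂μ ≤ C) : ∫⁻ x, f x ∂μ ≤ C := by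
  by_contra! hC
  simp_rw [lintegral_eq_nnreal, lt_iSup_iff] at hC
  obtain ⟨g₀, hg₀, hC⟩ := hC
  rw [← SimpleFunc.lintegral_eq_lintegral] at hC
  obtain ⟨g, hg, hgt, hCg⟩ := SimpleFunc.exists_lt_lintegral_simpleFunc_of_lt_lintegral hC
  exact hCg.not_ge (h _ g.measurable.coe_nnreal_ennreal
    (fun x => (ENNReal.coe_le_coe.2 (hg x)).trans (hg₀ x)) hgt.ne)

theorem IsWeight.lintegral_rpow_mul_le_of_forall_le_of_ne_top [SigmaFinite μ]
    (hw : IsWeight μ w) (hp : 0 < p) {f : α → ℝ≥0∞} (hf : Measurable f) {C : ℝ≥0∞}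
    (h : ∀ F : α → ℝ≥0∞, Measurable F → (∀ x, F x ≤ f x) → ∫⁻ x, F x ^ p * w x ∂μ ≠ ∞ →
      ∫⁻ x, F x ^ p * w x ∂μ ≤ C) : ∫⁻ x, f x ^ p * w x ∂μ ≤ C := by
  have := SigmaFinite.withDensity_of_ne_top hw.ae_ne_top
  rw [← hw.lintegral_withDensity (hf.pow_const p)]
  refine lintegral_le_of_forall_le_of_ne_top fun g hg hgf hgt => ?_
  have hpow (x : α) : (g x ^ p⁻¹) ^ p = g x := ENNReal.rpow_inv_rpow hp.ne' _
  rw [hw.lintegral_withDensity hg] at hgt ⊢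
  have hF := h (fun x => g x ^ p⁻¹) (hg.pow_const _)
    (fun x => (ENNReal.rpow_inv_le_iff hp).2 (hgf x))
  simp only [hpow] at hF
  exact hF hgt

end Duality

/-- The weighted `L^p` estimate of a family `f` by a family `g`, for all `A_p` weights, with a
constant that depends only on the `A_p` constant. -/
def WeightedBound (p q : ℝ) {ι : Type*} (f g : ι → ℝ → ℝ≥0∞) : Prop :=
  ∀ K : ℝ≥0, ∃ C : ℝ≥0, ∀ w, IsApWeight p q K w → ∀ i,
    ∫⁻ x, f i x ^ p * w x ≤ C * ∫⁻ x, g i x ^ p * w x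

namespace WeightedBound

variable {p q p₀ q₀ : ℝ} {ι : Type*} {f g : ι → ℝ → ℝ≥0∞}

theorem ae_eq_zero (h : WeightedBound p q f g) (hpq : p.HolderConjugate q)
    (hf : ∀ i, Measurable (f i)) {i : ι} (hi : ∀ᵐ x, g i x = 0) : ∀ᵐ x, f i x = 0 := by
  obtain ⟨C, hC⟩ := h 1
  have hg0 : ∫⁻ x, g i x ^ p * 1 = 0 := by
    refine (lintegral_congr_ae ?_).trans lintegral_zero
    filter_upwards [hi] with x hx
    simp [hx, hpq.pos]
  have hf0 := hC _ (isApWeight_one hpq) i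
  rw [hg0, mul_zero, nonpos_iff_eq_zero,
    lintegral_eq_zero_iff (((hf i).pow_const p).mul_const 1)] at hf0
  filter_upwards [hf0] with x hx
  simpa [hpq.pos, hpq.pos.not_gt] using hx

theorem exists_lintegral_mul_le (h : WeightedBound p q f g) (hpq : p.HolderConjugate q)
    (K L : ℝ≥0) : ∃ D : ℝ≥0, ∀ U V i, IsAOneWeight K U → IsAOneWeight L V →
      (∀ x, g i x ≤ U x) → ∫⁻ x, f i x * V x ≤ (1 + D) * ∫⁻ x, U x * V x := by
  obtain ⟨C, hC⟩ := h (L ^ p⁻¹ * K ^ q⁻¹)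
  exact ⟨C, fun U V i hU hV hgU => lintegral_mul_le_one_add_mul hpq.lt.le hU.toIsWeight
    hV.measurable hgU (hC _ (hV.mul_rpow hpq hU) i)⟩

/-- Rubio de Francia's extrapolation theorem: the bound follows by duality, the function to be
estimated and the dual function being replaced by their `A₁` majorants. -/
theorem extrapolate (h : WeightedBound p₀ q₀ f g) (hpq₀ : p₀.HolderConjugate q₀)
    (hpq : p.HolderConjugate q) (hf : ∀ i, Measurable (f i)) (hg : ∀ i, Measurable (g i)) :
    WeightedBound p q f g := by
  intro K
  obtain ⟨L₁, hL₁⟩ := exists_isAOneWeight_majorant hpq K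
  obtain ⟨L₂, hL₂⟩ := exists_isAOneWeight_majorant hpq.symm K
  obtain ⟨D, hD⟩ := h.exists_lintegral_mul_le hpq₀ L₁ L₂
  refine ⟨(4 * (1 + D)) ^ p, fun w hw i => ?_⟩
  push_cast [ENNReal.coe_rpow_of_nonneg _ hpq.pos.le]
  by_cases hgt : ∫⁻ x, g i x ^ p * w x = ∞
  · simp [hgt, ENNReal.mul_top, hpq.pos.not_gt]
  refine hw.lintegral_rpow_mul_le_of_forall_le_of_ne_top hpq.pos (hf i) fun F hF hFf hFt => ?_
  have hdual := hw.lintegral_rpow_sub_one_mul_rpow hpq F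
  by_cases hF0 : ∀ᵐ x, F x ^ (p - 1) * w x = 0
  · rw [← hdual]
    refine (lintegral_eq_zero_of_ae_eq_zero ?_).trans_le zero_le
    filter_upwards [hF0] with x hx
    simp [hx, hpq.symm.pos]
  have hg0 : ¬ ∀ᵐ x, g i x = 0 := by
    refine fun hg0 => hF0 ?_
    filter_upwards [h.ae_eq_zero hpq₀ hf hg0] with x hx
    simp [nonpos_iff_eq_zero.1 ((hFf x).trans_eq hx), hpq.sub_one_pos]
  obtain ⟨U, hU, hgU, hUG⟩ := hL₁ w hw _ (hg i) hgt hg0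
  obtain ⟨V, hV, hFV, hVF⟩ := hL₂ _ (hw.dual hpq) (fun x => F x ^ (p - 1) * w x)
    ((hF.pow_const _).mul hw.measurable) (hdual.trans_ne hFt) hF0
  refine hw.lintegral_rpow_mul_le_of_lintegral_mul_le hpq hU.measurable hV.measurable hFt hFV ?_
    hUG (hVF.trans_eq (by rw [hdual]))
  exact (lintegral_mono fun x => mul_le_mul_left (hFf x) _).trans (hD U V i hU hV hgU)

end WeightedBound

/-! ### Mixed norms -/

section MixedNorm

variable {n : ℕ}

theorem mixedNorm_succ (p : Fin (n + 1) → ℝ) (F : (Fin (n + 1) → ℝ) → ℝ≥0∞) :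
    mixedNorm p F = (∫⁻ s : ℝ, mixedNorm (fun j : Fin n => p j.castSucc)
      (fun y : Fin n → ℝ => F (Fin.snoc (α := fun _ => ℝ) y s)) ^ p (Fin.last n))
        ^ (1 / p (Fin.last n)) := rfl

theorem mixedNorm_rpow (p : Fin n → ℝ) {t : ℝ} (ht : t ≠ 0) (F : (Fin n → ℝ) → ℝ≥0∞) :
    mixedNorm p (fun x => F x ^ (1 / t)) = mixedNorm (fun j => p j / t) F ^ (1 / t) := by
  induction n with
  | zero => rfl
  | succ n ih =>
    simp only [mixedNorm_succ, ih, ← ENNReal.rpow_mul]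
    congr 1
    · simp only [one_div_mul_eq_div]
    · field_simp

theorem measurable_snoc :
    Measurable fun z : (Fin n → ℝ) × ℝ => Fin.snoc (α := fun _ => ℝ) z.1 z.2 := by
  refine measurable_pi_lambda _ fun j => ?_
  refine Fin.lastCases ?_ (fun i => ?_) j
  · simpa using measurable_snd
  · simp only [Fin.snoc_castSucc]
    exact (measurable_pi_apply i).comp measurable_fst

theorem measurable_mixedNorm (p : Fin n → ℝ) {α : Type*} [MeasurableSpace α]
    {F : α → (Fin n → ℝ) → ℝ≥0∞} (hF : Measurable (Function.uncurry F)) :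
    Measurable fun a => mixedNorm p (F a) := by
  induction n generalizing α with
  | zero => exact hF.comp (measurable_id.prodMk measurable_const)
  | succ n ih =>
    have h : Measurable fun z : α × ℝ => mixedNorm (fun j : Fin n => p j.castSucc)
        (fun y : Fin n → ℝ => F z.1 (Fin.snoc (α := fun _ => ℝ) y z.2)) :=
      ih _ (F := fun (z : α × ℝ) y => F z.1 (Fin.snoc (α := fun _ => ℝ) y z.2)) <|
        hF.comp ((measurable_fst.comp measurable_fst).prodMk
          (measurable_snoc.comp (measurable_snd.prodMk (measurable_snd.comp measurable_fst))))
    exact (h.pow_const _).lintegral_prod_right'.pow_const _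

theorem ae_insertNth_iff (k : Fin (n + 1)) (P : (Fin (n + 1) → ℝ) → Prop) :
    (∀ᵐ x, P x) ↔ ∀ᵐ z : ℝ × (Fin n → ℝ), P (k.insertNth (α := fun _ => ℝ) z.1 z.2) := by
  have h := (volume_preserving_piFinSuccAbove (fun _ : Fin (n + 1) => ℝ) k).symm
  rw [← h.map_eq, (MeasurableEquiv.measurableEmbedding _).ae_map_iff]
  rfl

theorem mixedNorm_congr_ae (p : Fin n → ℝ) {F G : (Fin n → ℝ) → ℝ≥0∞}
    (h : F =ᵐ[volume] G) : mixedNorm p F = mixedNorm p G := by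
  induction n with
  | zero =>
    obtain ⟨x, hx⟩ := h.exists
    rwa [Subsingleton.elim x Fin.elim0] at hx
  | succ n ih =>
    have h' := (ae_insertNth_iff (Fin.last n) fun x => F x = G x).1 h
    simp only [Fin.insertNth_last'] at h'
    rw [mixedNorm_succ, mixedNorm_succ]
    congr 1
    refine lintegral_congr_ae ?_
    filter_upwards [Measure.ae_ae_of_ae_prod h'] with s hs
    rw [ih _ hs]

theorem lintegral_mixedNorm_rpow_mul {q : Fin (n + 1) → ℝ} (hq : q (Fin.last n) ≠ 0)
    {H : (Fin (n + 1) → ℝ) → ℝ → ℝ≥0∞} (hH : Measurable (Function.uncurry H)) {w : ℝ → ℝ≥0∞}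
    (hw : Measurable w) :
    ∫⁻ s, (mixedNorm q fun y => H y s) ^ q (Fin.last n) * w s =
      ∫⁻ u, ∫⁻ s, (mixedNorm (fun j : Fin n => q j.castSucc) fun y =>
        H (Fin.snoc (α := fun _ => ℝ) y u) s) ^ q (Fin.last n) * w s := by
  have hm : Measurable fun z : ℝ × ℝ => (mixedNorm (fun j : Fin n => q j.castSucc) fun y =>
      H (Fin.snoc (α := fun _ => ℝ) y z.2) z.1) ^ q (Fin.last n) :=
    (measurable_mixedNorm _
      (F := fun (z : ℝ × ℝ) y => H (Fin.snoc (α := fun _ => ℝ) y z.2) z.1)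
      (hH.comp ((measurable_snoc.comp (measurable_snd.prodMk
        (measurable_snd.comp measurable_fst))).prodMk
          (measurable_fst.comp measurable_fst)))).pow_const _
  rw [← lintegral_lintegral_swap (hm.mul (hw.comp measurable_fst)).aemeasurable]
  refine lintegral_congr fun s => ?_
  rw [mixedNorm_succ, ← ENNReal.rpow_mul, one_div_mul_cancel hq, ENNReal.rpow_one]
  exact (lintegral_mul_const _ (hm.comp measurable_prodMk_left)).symm

end MixedNorm

/-! ### Maximal operators in the coordinate directions -/

section Directional

variable {n : ℕ}

theorem directionalMaximal_eq_intervalMaximal (k : Fin n) (F : (Fin n → ℝ) → ℝ≥0∞)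
    (x : Fin n → ℝ) : directionalMaximal k F x =
      intervalMaximal volume (fun s => F (Function.update x k s)) (x k) := by
  refine le_antisymm ?_ (intervalMaximal_le_iff.2 fun q hx => ?_)
  · refine iSup_le fun a => iSup_le fun b => iSup_le fun _ => iSup_le fun hx => ?_
    exact ENNReal.div_le_of_le_mul (setLIntegral_Icc_le_intervalMaximal_volume_mul _ hx)
  · rw [setLAverage_eq, Real.volume_Icc]
    rcases (hx.1.trans hx.2).eq_or_lt with hq | hq
    · simp [← hq]
    · exact le_iSup₂_of_le (q.1 : ℝ) (q.2 : ℝ) (le_iSup₂_of_le hq hx le_rfl)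

theorem measurable_uncurry_intervalMaximal {β : Type*} [MeasurableSpace β] {G : β → ℝ → ℝ≥0∞}
    (hG : Measurable (Function.uncurry G)) :
    Measurable (Function.uncurry fun z => intervalMaximal volume (G z)) := by
  refine measurable_iSup_mem (s := fun q : ℚ × ℚ => Prod.snd ⁻¹' Icc (q.1 : ℝ) q.2)
    (f := fun q (z : β × ℝ) => ⨍⁻ y in Icc (q.1 : ℝ) q.2, G z.1 y ∂volume)
    (fun q => measurable_snd measurableSet_Icc) fun q => ?_
  simp only [setLAverage_eq]
  exact (hG.lintegral_prod_right'.comp measurable_fst).div_const _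

theorem measurable_directionalMaximal (k : Fin n) {F : (Fin n → ℝ) → ℝ≥0∞}
    (hF : Measurable F) : Measurable (directionalMaximal k F) := by
  have h : Measurable (Function.uncurry fun (x : Fin n → ℝ) s => F (Function.update x k s)) :=
    hF.comp measurable_update'
  rw [funext (directionalMaximal_eq_intervalMaximal k F)]
  exact (measurable_uncurry_intervalMaximal h).comp (measurable_id.prodMk (measurable_pi_apply k))

theorem directionalMaximal_congr_ae (k : Fin n) {F G : (Fin n → ℝ) → ℝ≥0∞}
    (h : F =ᵐ[volume] G) : directionalMaximal k F =ᵐ[volume] directionalMaximal k G := by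
  cases n with
  | zero => exact k.elim0
  | succ n =>
    have h' : ∀ᵐ y : Fin n → ℝ, ∀ᵐ s : ℝ, F (k.insertNth (α := fun _ => ℝ) s y) =
        G (k.insertNth (α := fun _ => ℝ) s y) :=
      Measure.ae_ae_of_ae_prod (Measure.measurePreserving_swap.quasiMeasurePreserving.ae
        ((ae_insertNth_iff k fun x => F x = G x).1 h))
    refine (ae_insertNth_iff k fun x => directionalMaximal k F x = directionalMaximal k G x).2 ?_
    filter_upwards [Measure.quasiMeasurePreserving_snd.ae h'] with z hz
    simp only [directionalMaximal, Fin.update_insertNth]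
    refine iSup_congr fun a => iSup_congr fun b => iSup_congr fun _ => iSup_congr fun _ => ?_
    rw [lintegral_congr_ae (ae_restrict_of_ae hz)]

theorem measurable_foldl_directionalMaximal {ι : Type*} (e : ι → Fin n) (l : List ι)
    {F : (Fin n → ℝ) → ℝ≥0∞} (hF : Measurable F) :
    Measurable (l.foldl (fun G i => directionalMaximal (e i) G) F) := by
  induction l generalizing F with
  | nil => exact hF
  | cons i _ ih => exact ih (measurable_directionalMaximal (e i) hF)

theorem foldl_directionalMaximal_congr_ae (l : List (Fin n)) {F G : (Fin n → ℝ) → ℝ≥0∞}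
    (h : F =ᵐ[volume] G) : l.foldl (fun G k => directionalMaximal k G) F =ᵐ[volume]
      l.foldl (fun G k => directionalMaximal k G) G := by
  induction l generalizing F G with
  | nil => exact h
  | cons k _ ih => exact ih (directionalMaximal_congr_ae k h)

theorem measurable_composedMaximal {F : (Fin n → ℝ) → ℝ≥0∞} (hF : Measurable F) :
    Measurable (composedMaximal F) := by
  rw [composedMaximal, Fin.foldl_eq_foldl_finRange]
  exact measurable_foldl_directionalMaximal id _ hF

theorem composedMaximal_congr_ae {F G : (Fin n → ℝ) → ℝ≥0∞} (h : F =ᵐ[volume] G) :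
    composedMaximal F =ᵐ[volume] composedMaximal G := by
  rw [composedMaximal, composedMaximal, Fin.foldl_eq_foldl_finRange, Fin.foldl_eq_foldl_finRange]
  exact foldl_directionalMaximal_congr_ae _ h

theorem directionalMaximal_castSucc (k : Fin n) (F : (Fin (n + 1) → ℝ) → ℝ≥0∞)
    (y : Fin n → ℝ) (s : ℝ) :
    directionalMaximal k.castSucc F (Fin.snoc (α := fun _ => ℝ) y s) =
      directionalMaximal k (fun z => F (Fin.snoc (α := fun _ => ℝ) z s)) y := by
  simp only [directionalMaximal, Fin.snoc_castSucc, Fin.snoc_update]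

theorem foldl_directionalMaximal_castSucc (F : (Fin (n + 1) → ℝ) → ℝ≥0∞)
    (y : Fin n → ℝ) (s : ℝ) :
    Fin.foldl n (fun G k => directionalMaximal k.castSucc G) F (Fin.snoc (α := fun _ => ℝ) y s) =
      composedMaximal (fun z => F (Fin.snoc (α := fun _ => ℝ) z s)) y := by
  rw [composedMaximal, Fin.foldl_eq_foldl_finRange, Fin.foldl_eq_foldl_finRange]
  generalize List.finRange n = l
  induction l generalizing F with
  | nil => rfl
  | cons k l ih => simp only [List.foldl_cons, ih, directionalMaximal_castSucc]

theorem composedMaximal_snoc (F : (Fin (n + 1) → ℝ) → ℝ≥0∞) (y : Fin n → ℝ) (s : ℝ) :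
    composedMaximal F (Fin.snoc (α := fun _ => ℝ) y s) = intervalMaximal volume
      (fun u => composedMaximal (fun z => F (Fin.snoc (α := fun _ => ℝ) z u)) y) s := by
  rw [composedMaximal, Fin.foldl_succ_last, directionalMaximal_eq_intervalMaximal]
  simp only [Fin.update_snoc_last, Fin.snoc_last, foldl_directionalMaximal_castSucc]

theorem measurable_composedMaximal_snoc {F : (Fin (n + 1) → ℝ) → ℝ≥0∞}
    (hF : Measurable F) : Measurable (Function.uncurry fun (y : Fin n → ℝ) (s : ℝ) =>
      composedMaximal (fun z => F (Fin.snoc (α := fun _ => ℝ) z s)) y) := by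
  simp only [← foldl_directionalMaximal_castSucc, Fin.foldl_eq_foldl_finRange]
  exact (measurable_foldl_directionalMaximal _ _ hF).comp measurable_snoc

end Directional

/-! ### Boundedness on mixed Lebesgue spaces -/

section Boundedness

variable {n : ℕ}

/-- The estimate at the exponent `q (Fin.last n)` follows from the induction hypothesis by Fubini's
theorem; extrapolation gives the other exponents. -/
theorem weightedBound_mixedNorm_intervalMaximal {q : Fin n → ℝ} (hq : ∀ j, 1 < q j) {r r' : ℝ}
    (hr : r.HolderConjugate r') : WeightedBound r r'
      (fun (G : {G : (Fin n → ℝ) → ℝ → ℝ≥0∞ // Measurable (Function.uncurry G)}) s =>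
        mixedNorm q fun y => intervalMaximal volume (G.1 y) s)
      (fun G s => mixedNorm q fun y => G.1 y s) := by
  induction n generalizing r r' with
  | zero =>
    intro K
    obtain ⟨C, hC⟩ := exists_lintegral_intervalMaximal_rpow_mul_le hr K
    exact ⟨C, fun w hw G => hC w hw (G.1 Fin.elim0)
      (G.2.comp (measurable_const.prodMk measurable_id))⟩
  | succ n ih =>
    have hlast := Real.HolderConjugate.conjExponent (hq (Fin.last n))
    have hmixed (H : (Fin (n + 1) → ℝ) → ℝ → ℝ≥0∞) (hH : Measurable (Function.uncurry H)) :
        Measurable fun s => mixedNorm q fun y => H y s :=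
      measurable_mixedNorm q (F := fun s y => H y s) (hH.comp measurable_swap)
    refine WeightedBound.extrapolate (fun K => ?_) hlast hr
      (fun G => hmixed _ (measurable_uncurry_intervalMaximal G.2)) fun G => hmixed _ G.2
    obtain ⟨C, hC⟩ := ih (fun j => hq j.castSucc) hlast K
    refine ⟨C, fun w hw G => ?_⟩
    rw [lintegral_mixedNorm_rpow_mul hlast.ne_zero
        (measurable_uncurry_intervalMaximal G.2) hw.measurable,
      lintegral_mixedNorm_rpow_mul hlast.ne_zero G.2 hw.measurable,
      ← lintegral_const_mul' _ _ ENNReal.coe_ne_top]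
    exact lintegral_mono fun u => hC w hw ⟨fun y => G.1 (Fin.snoc (α := fun _ => ℝ) y u),
      G.2.comp ((measurable_snoc.comp (measurable_fst.prodMk measurable_const)).prodMk
        measurable_snd)⟩

theorem mixedNorm_le_of_lintegral_rpow_le {q : Fin (n + 1) → ℝ} (hq : 0 < q (Fin.last n))
    {F G : (Fin (n + 1) → ℝ) → ℝ≥0∞} {C : ℝ≥0∞}
    (h : ∫⁻ s, mixedNorm (fun j : Fin n => q j.castSucc)
        (fun y => F (Fin.snoc (α := fun _ => ℝ) y s)) ^ q (Fin.last n) ≤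
      C ^ q (Fin.last n) * ∫⁻ s, mixedNorm (fun j : Fin n => q j.castSucc)
        (fun y => G (Fin.snoc (α := fun _ => ℝ) y s)) ^ q (Fin.last n)) :
    mixedNorm q F ≤ C * mixedNorm q G := by
  have hq' := one_div_nonneg.2 hq.le
  refine (ENNReal.rpow_le_rpow h hq').trans_eq ?_
  rw [ENNReal.mul_rpow_of_nonneg _ _ hq', ← ENNReal.rpow_mul, mul_one_div_cancel hq.ne',
    ENNReal.rpow_one, mixedNorm_succ]

theorem exists_mixedNorm_composedMaximal_le {q : Fin n → ℝ} (hq : ∀ j, 1 < q j) :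
    ∃ C : ℝ≥0, ∀ F : (Fin n → ℝ) → ℝ≥0∞, Measurable F →
      mixedNorm q (composedMaximal F) ≤ C * mixedNorm q F := by
  induction n with
  | zero => exact ⟨1, fun F _ => by simp [composedMaximal]⟩
  | succ n ih =>
    set b := q (Fin.last n) with hb
    have hb1 : 1 < b := hq _
    have hb0 : 0 < b := one_pos.trans hb1
    obtain ⟨C, hC⟩ := ih fun j => hq j.castSucc
    obtain ⟨D, hD⟩ := weightedBound_mixedNorm_intervalMaximal (fun j => hq j.castSucc)
      (Real.HolderConjugate.conjExponent hb1) 1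
    refine ⟨D ^ (1 / b) * C, fun F hF => mixedNorm_le_of_lintegral_rpow_le hb0 ?_⟩
    have hlast := hD _ (isApWeight_one (Real.HolderConjugate.conjExponent hb1))
      ⟨_, measurable_composedMaximal_snoc hF⟩
    simp only [mul_one] at hlast
    simp only [composedMaximal_snoc, ← hb]
    push_cast [ENNReal.coe_rpow_of_nonneg _ (one_div_nonneg.2 hb0.le)]
    rw [ENNReal.mul_rpow_of_nonneg _ _ hb0.le, ← ENNReal.rpow_mul, one_div_mul_cancel hb0.ne',
      ENNReal.rpow_one, mul_assoc,
      ← lintegral_const_mul' _ _ (ENNReal.rpow_ne_top_of_nonneg hb0.le ENNReal.coe_ne_top)]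
    refine hlast.trans (mul_le_mul_right (lintegral_mono fun s => ?_) _)
    rw [← ENNReal.mul_rpow_of_nonneg _ _ hb0.le]
    exact ENNReal.rpow_le_rpow (hC _ (hF.comp (measurable_snoc.comp
      (measurable_id.prodMk measurable_const)))) hb0.le

end Boundedness

theorem theorem1_general {n : ℕ} (p : Fin n → ℝ) {t : ℝ} (ht : 0 < t) (htp : ∀ j, t < p j) :
    ∃ C : ℝ≥0, 0 < C ∧ ∀ F : (Fin n → ℝ) → ℝ≥0∞, AEMeasurable F volume →
      AEMeasurable (fun x => composedMaximal (fun y => F y ^ t) x ^ (1 / t)) volume ∧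
      mixedNorm p (fun x => composedMaximal (fun y => F y ^ t) x ^ (1 / t)) ≤
        C * mixedNorm p F := by
  obtain ⟨C, hC⟩ := exists_mixedNorm_composedMaximal_le fun j => (one_lt_div ht).2 (htp j)
  refine ⟨(C + 1) ^ (1 / t), by positivity, fun F hF => ?_⟩
  obtain ⟨G, hG, hFG⟩ := hF.pow_const t
  have hMG : composedMaximal (fun y => F y ^ t) =ᵐ[volume] composedMaximal G :=
    composedMaximal_congr_ae hFG
  have hF' : F = fun x => (F x ^ t) ^ (1 / t) := by
    simp only [one_div, ENNReal.rpow_rpow_inv ht.ne']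
  refine ⟨AEMeasurable.pow_const ⟨_, measurable_composedMaximal hG, hMG⟩ _, ?_⟩
  calc mixedNorm p (fun x => composedMaximal (fun y => F y ^ t) x ^ (1 / t))
      = mixedNorm (fun j => p j / t) (composedMaximal G) ^ (1 / t) := by
        rw [mixedNorm_rpow p ht.ne', mixedNorm_congr_ae _ hMG]
    _ ≤ ((C + 1 : ℝ≥0) * mixedNorm (fun j => p j / t) G) ^ (1 / t) := by
        gcongr
        exact (hC G hG).trans (by gcongr; exact le_self_add)
    _ = ((C + 1) ^ (1 / t) : ℝ≥0) * mixedNorm p F := by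
        rw [ENNReal.mul_rpow_of_nonneg _ _ (one_div_nonneg.2 ht.le), ← mixedNorm_congr_ae _ hFG,
          ← mixedNorm_rpow p ht.ne', ← hF', ENNReal.coe_rpow_of_nonneg _ (one_div_nonneg.2 ht.le)]

theorem theorem1 (n : ℕ) (p : Fin n → ℝ) (hp : ∀ j, 0 < p j)
    (t : ℝ) (ht : 0 < t) (htp : ∀ j, t < p j) :
    ∃ C : ℝ≥0, 0 < C ∧ ∀ f ∈ mixedLebesgue p,
      AEMeasurable (iteratedMaximal t f) volume ∧
      mixedNorm p (iteratedMaximal t f) ≤ C * mixedNorm p (fun x => ‖f x‖ₑ) := by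
  obtain ⟨C, hC, h⟩ := theorem1_general p ht htp
  exact ⟨C, hC, fun f hf => h _ hf.1.enorm⟩
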